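/- **Setting.** Let $\mathbb W$ be the 3-Walsh group: sequences $x=([x]_n)_{n\in\mathbb Z}$ in $\mathbb Z/3\mathbb Z$ with $[x]_n=0$ for all sufficiently large $n$, with digitwise addition, absolute value $|x|=\max\{3^n:[x]_n\neq 0\}$ ($|0|=0$), the metric $|x-y|$, and Haar measure normalised by $|B_1(0)|=1$ (open balls), so that $|B_{3^n}(x)|=3^n$. An *interval* is a ball $B_{3^n}(x)$, $n\in\mathbb Z$; its children are $\mathrm{ch}_j(I)=\{x\in I:[x]_{\log_3|I|-1}=j\}$, $j\in\{0,1,2\}$. Put $\exp_\xi(x)=(e^{2\pi i/3})^{\sum_{j+k=-1}[\xi]_j[x]_k}$. A *tile* (resp. *tritile*) is a product $I\times\omega$ of intervals with $|I||\omega|=1$ (resp. $3$). The wave packet of a tile $P=I_P\times\omega_P$ is $w_P=|I_P|^{-1}\exp_{\xi_P}\mathbf 1_{I_P}$, where $\xi_P\in\omega_P$ is the point whose digits $[\xi_P]_j$ vanish for $3^j<|\omega_P|$. A tritile $\mathbf P=I_{\mathbf P}\times\omega_{\mathbf P}$ has the subtiles $\mathbf P_u=I_{\mathbf P}\times \mathrm{ch}_u(\omega_{\mathbf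 P})$, $u\in\{0,1,2\}$. For a complex Banach space $X$, a function $f:\mathbb W\to X$ is *Schwartz* if for some integer $N>0$ it is supported in $B_{3^N}(0)$ and constant on every interval of length less than $3^{-N}$. For such $f$ let $\mathcal E[f](\mathbf P)=\big(\int_{\mathbb W} f(x)\,w_{\mathbf P_u}(x)\,dx\big)_{u\in\{0,1,2\}}\in X^3$, where $X^3$ carries the maximum norm. For tritiles write $\mathbf Q\le\mathbf P$ if $I_{\mathbf Q}\subseteq I_{\mathbf P}$ and $\omega_{\mathbf Q}\supseteq\omega_{\mathbf P}$. The *tree* with top $\mathbf P$ is $T=\{\mathbf Q:\mathbf Q\le\mathbf P\}$, with $\mu(T)=|I_{\mathbf P}|$ and $\|F\|_{S^\infty(T)}=\sup_{\mathbf Q\in T}|F(\mathbf Q)|$ for complex-valued functions $F$ on the set of tritiles. The *strip* with top an interval $I$ is $D=\{\mathbf P: I_{\mathbf P}\subseteq I\}$, with $I_D=I$ and $\nu(D)=|I|$. Given a premeasure $\sigma$ and a size $\|\cdot\|_{S(E)}$ on a family of generating sets $E$, let $\sigma(A)$ be the infimum of $\sum_k\sigma(E_k)$ over countable covers $(E_k)$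 of $A$ by generating sets, $\|F\|_S=\sup_E\|F\|_{S(E)}$, $\sigma(\|F\|_S>\lambda)=\inf\{\sigma(A):\|\mathbf 1_{A^c}F\|_S\le\lambda\}$, and $$\|F\|_{L^p_\sigma S}=\Big(\int_0^\infty p\lambda^{p-1}\sigma(\|F\|_S>\lambda)\,d\lambda\Big)^{1/p}\quad(0<p<\infty),\qquad \|F\|_{L^\infty_\sigma S}=\|F\|_S .$$ For $q\in(0,\infty]$ the averaged size on strips is $\|F\|_{\overline{L}{}^q_\mu S^\infty(D)}=|I_D|^{-1/q}\|\mathbf 1_DF\|_{L^q_\mu S^\infty}$ (with $1/\infty=0$); here $\overline{L}{}^q_\mu$ stands for the averaged $L^q_\mu$. The resulting iterated quasinorm, built on strips with premeasure $\nu$, is $\|F\|_{L^p_\nu \overline{L}{}^q_\mu S^\infty}$. A complex Banach space $X$ is *$r$-Hilbertian*, $r\in[2,\infty)$, if there are a Hilbert space $H$ and a Banach space $Y$ forming an interpolation couple such that $X$ is isomorphic to the complex interpolation space $[H,Y]_\theta$ with $\frac1r=\frac{1-\theta}2$. **Theorem.** Let $r\in[2,\infty)$ and let $X$ be an $r$-Hilbertian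 complex Banach space. Let $p\in(1,\infty)$, let $m=\min(p,r)$ with conjugate exponent $m'=m/(m-1)$, and let $q\in(m'(r-1),\infty]$. Then there is a constant $C<\infty$, depending only on $X,r,p,q$, such that $$\big\|\,\|\mathcal E[f]\|_{X^3}\,\big\|_{L^p_\nu \overline{L}{}^q_\mu S^\infty}\le C\,\|f\|_{L^p(\mathbb W;X)}\qquad\text{for all Schwartz functions } f:\mathbb W\to X .$$ -/

import Mathlib

open MeasureTheory Set Filter
open scoped ENNReal NNReal BoundedContinuousFunction

universe u v

/-! ### The 3-Walsh group -/

/-- Sequences of ternary digits indexed by `ℤ` with `x n = 0` for `n` sufficiently large. -/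
def walshSubgroup : AddSubgroup (ℤ → ZMod 3) where
  carrier := {x | ∃ N : ℤ, ∀ n, N ≤ n → x n = 0}
  zero_mem' := ⟨0, fun _ _ => rfl⟩
  add_mem' := by
    rintro x y ⟨N, hN⟩ ⟨M, hM⟩
    refine ⟨max N M, fun n hn => ?_⟩
    simp [hN n (le_trans (le_max_left _ _) hn), hM n (le_trans (le_max_right _ _) hn)]
  neg_mem' := by
    rintro x ⟨N, hN⟩
    exact ⟨N, fun n hn => by simp [hN n hn]⟩

/-- The 3-Walsh group `𝕎`, with digitwise addition modulo `3`. -/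
def Walsh : Type := walshSubgroup

namespace Walsh

instance : AddCommGroup Walsh := inferInstanceAs (AddCommGroup walshSubgroup)

/-- The `n`-th digit `[x]_n`. -/
def digit (x : Walsh) (n : ℤ) : ZMod 3 := x.1 n

theorem ext_digit {x y : Walsh} (h : ∀ n, x.digit n = y.digit n) : x = y :=
  Subtype.ext (funext h)

@[simp] theorem digit_zero (n : ℤ) : (0 : Walsh).digit n = 0 := rfl
@[simp] theorem digit_add (x y : Walsh) (n : ℤ) :
    (x + y).digit n = x.digit n + y.digit n := rfl
@[simp] theorem digit_neg (x : Walsh) (n : ℤ) : (-x).digit n = -x.digit n := rfl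
@[simp] theorem digit_sub (x y : Walsh) (n : ℤ) :
    (x - y).digit n = x.digit n - y.digit n := by
  rw [sub_eq_add_neg, sub_eq_add_neg, digit_add, digit_neg]

/-- The element whose only (possibly) nonzero digit is `d`, in position `n`. -/
def single (n : ℤ) (d : ZMod 3) : Walsh :=
  ⟨fun j => if j = n then d else 0, n + 1, fun j hj => if_neg (by omega)⟩

theorem digit_single (n : ℤ) (d : ZMod 3) (j : ℤ) :
    (single n d).digit j = if j = n then d else 0 := rfl

/-- The contribution of the `n`-th digit to the absolute value. -/
noncomputable def absTerm (x : Walsh) (n : ℤ) : ℝ :=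
  if x.digit n = 0 then 0 else (3 : ℝ) ^ n

/-- The absolute value `|x| = max {3 ^ n : [x]_n ≠ 0}`, with `|0| = 0`. -/
noncomputable def absVal (x : Walsh) : ℝ := ⨆ n : ℤ, x.absTerm n

theorem absTerm_nonneg (x : Walsh) (n : ℤ) : 0 ≤ x.absTerm n := by
  unfold absTerm; split_ifs <;> positivity

theorem absTerm_bdd (x : Walsh) : BddAbove (range x.absTerm) := by
  obtain ⟨N, hN⟩ := x.2
  refine ⟨(3 : ℝ) ^ N, ?_⟩
  rintro _ ⟨n, rfl⟩
  unfold absTerm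
  split_ifs with h
  · positivity
  · have : n ≤ N := by
      by_contra hn
      exact h (hN n (by omega))
    exact zpow_le_zpow_right₀ (by norm_num) this

theorem absTerm_le (x : Walsh) (n : ℤ) : x.absTerm n ≤ x.absVal := le_ciSup x.absTerm_bdd n

noncomputable instance : NormedAddCommGroup Walsh :=
  AddGroupNorm.toNormedAddCommGroup
    { toFun := absVal
      map_zero' := by simp [absVal, absTerm]
      add_le' := fun x y => by
        refine ciSup_le fun n => ?_
        refine le_trans ?_ (add_le_add (absTerm_le x n) (absTerm_le y n))
        have hx := absTerm_nonneg x n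
        have hy := absTerm_nonneg y n
        by_cases h1 : x.digit n = 0
        · by_cases h2 : y.digit n = 0
          · simp [absTerm, h1, h2]
          · simp [absTerm, h1, h2]
        · have : (x + y).absTerm n ≤ (3 : ℝ) ^ n := by
            unfold absTerm; split_ifs
            · positivity
            · exact le_rfl
          have h3 : x.absTerm n = (3 : ℝ) ^ n := by simp [absTerm, h1]
          linarith
      neg' := fun x => by simp [absVal, absTerm]
      eq_zero_of_map_eq_zero' := fun x hx => by
        refine ext_digit fun n => ?_
        by_contra hn
        have h1 := absTerm_le x n
        have h2 : x.absTerm n = (3 : ℝ) ^ n := if_neg hn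
        have h3 : (0 : ℝ) < (3 : ℝ) ^ n := by positivity
        have h4 : x.absVal = 0 := hx
        linarith }

theorem norm_def (x : Walsh) : ‖x‖ = x.absVal := rfl

theorem norm_lt_iff (x : Walsh) (n : ℤ) :
    ‖x‖ < (3 : ℝ) ^ n ↔ ∀ j, n ≤ j → x.digit j = 0 := by
  rw [norm_def]
  constructor
  · intro h j hj
    by_contra hx
    have h1 := absTerm_le x j
    rw [absTerm, if_neg hx] at h1
    have h2 : (3 : ℝ) ^ n ≤ (3 : ℝ) ^ j := zpow_le_zpow_right₀ (by norm_num) hj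
    linarith
  · intro h
    have h1 : x.absVal ≤ (3 : ℝ) ^ (n - 1) := by
      refine ciSup_le fun j => ?_
      unfold absTerm
      split_ifs with hj
      · positivity
      · have : j ≤ n - 1 := by
          by_contra hh
          exact hj (h j (by omega))
        exact zpow_le_zpow_right₀ (by norm_num) this
    exact lt_of_le_of_lt h1 (zpow_lt_zpow_right₀ (by norm_num) (by omega))

/-- Membership in the ball `B_{3^n}(x)`: agreement of all digits from position `n` on. -/
theorem mem_ball_iff (x y : Walsh) (n : ℤ) :
    y ∈ Metric.ball x ((3 : ℝ) ^ n) ↔ ∀ j, n ≤ j → y.digit j = x.digit j := by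
  rw [mem_ball_iff_norm, norm_lt_iff]
  simp only [digit_sub, sub_eq_zero]

/-- The element with digits `a 0, a 1, …` in the positions `-1, -2, …`. -/
def ofFrac (a : ℕ → ZMod 3) : Walsh :=
  ⟨fun j => if j < 0 then a (-j - 1).toNat else 0, 0, fun j hj => if_neg (by omega)⟩

theorem continuous_ofFrac : Continuous ofFrac := by
  rw [continuous_iff_continuousAt]
  intro a
  rw [ContinuousAt, Metric.tendsto_nhds]
  intro ε hε
  obtain ⟨m, hm⟩ := exists_pow_lt_of_lt_one hε (by norm_num : (1 / 3 : ℝ) < 1)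
  have hU : ∀ᶠ b in nhds a, ∀ i ∈ Finset.range m, b i = a i := by
    rw [Filter.eventually_all_finset]
    intro i _
    have : Tendsto (fun b : ℕ → ZMod 3 => b i) (nhds a) (nhds (a i)) :=
      (continuous_apply i).tendsto a
    rw [nhds_discrete (ZMod 3)] at this
    exact this.eventually (p := fun c => c = a i) (Filter.eventually_pure.2 rfl)
  filter_upwards [hU] with b hb
  have h1 : ofFrac b ∈ Metric.ball (ofFrac a) ((3 : ℝ) ^ (-(m : ℤ))) := by
    rw [mem_ball_iff]
    intro j hj
    change (if j < 0 then b (-j - 1).toNat else 0) = (if j < 0 then a (-j - 1).toNat else 0)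
    split_ifs with h
    · exact hb _ (Finset.mem_range.2 (by omega))
    · rfl
  refine lt_trans (Metric.mem_ball.1 h1) ?_
  simpa using hm

theorem isCompact_unitBall : IsCompact (Metric.ball (0 : Walsh) 1) := by
  have h : Metric.ball (0 : Walsh) 1 = range ofFrac := by
    ext x
    have h0 := mem_ball_iff 0 x 0
    rw [zpow_zero] at h0
    rw [h0]
    constructor
    · intro hx
      refine ⟨fun i => x.digit (-(i : ℤ) - 1), ext_digit fun j => ?_⟩
      change (if j < 0 then x.digit (-(((-j - 1).toNat : ℕ) : ℤ) - 1) else 0) = x.digit j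
      split_ifs with hj
      · congr 1
        omega
      · exact (hx j (by omega)).symm
    · rintro ⟨a, rfl⟩ j hj
      change (if j < 0 then a (-j - 1).toNat else 0) = 0
      exact if_neg (by omega)
  rw [h]
  exact isCompact_range continuous_ofFrac

/-- The unit ball as a compact set with nonempty interior. -/
def unitBall : TopologicalSpace.PositiveCompacts Walsh where
  carrier := Metric.ball 0 1
  isCompact' := isCompact_unitBall
  interior_nonempty' := by
    rw [Metric.isOpen_ball.interior_eq]
    exact ⟨0, Metric.mem_ball_self one_pos⟩

noncomputable instance : MeasurableSpace Walsh := borel Walsh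
instance : BorelSpace Walsh := ⟨rfl⟩

/-- The Haar measure on `𝕎`, normalised by `|B_1(0)| = 1`. -/
noncomputable instance : MeasureSpace Walsh where
  volume := Measure.addHaarMeasure unitBall

instance : (volume : Measure Walsh).IsAddHaarMeasure :=
  inferInstanceAs (Measure.addHaarMeasure unitBall).IsAddHaarMeasure

theorem volume_unitBall : volume (Metric.ball (0 : Walsh) 1) = 1 :=
  Measure.addHaarMeasure_self (K₀ := unitBall)

theorem volume_ball_succ (n : ℤ) :
    volume (Metric.ball (0 : Walsh) ((3 : ℝ) ^ (n + 1))) =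
      3 * volume (Metric.ball (0 : Walsh) ((3 : ℝ) ^ n)) := by
  have h : Metric.ball (0 : Walsh) ((3 : ℝ) ^ (n + 1)) =
      ⋃ d : ZMod 3, Metric.ball (single n d) ((3 : ℝ) ^ n) := by
    ext x
    simp only [mem_iUnion, mem_ball_iff]
    constructor
    · intro hx
      refine ⟨x.digit n, fun j hj => ?_⟩
      rw [digit_single]
      split_ifs with h
      · rw [h]
      · exact hx j (by omega)
    · rintro ⟨d, hd⟩ j hj
      rw [hd j (by omega), digit_single, if_neg (by omega), digit_zero]
  rw [h, measure_iUnion]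
  · have h1 : ∀ d : ZMod 3, volume (Metric.ball (single n d) ((3 : ℝ) ^ n)) =
        volume (Metric.ball (0 : Walsh) ((3 : ℝ) ^ n)) := fun d =>
      Measure.addHaar_ball_center volume _ _
    simp only [h1]
    rw [tsum_fintype, Finset.sum_const, Finset.card_univ, ZMod.card]
    simp
  · intro d e hde
    rw [Function.onFun, Set.disjoint_left]
    intro x hx hy
    have h1 := (mem_ball_iff _ _ _).1 hx n le_rfl
    have h2 := (mem_ball_iff _ _ _).1 hy n le_rfl
    rw [digit_single, if_pos rfl] at h1 h2
    exact hde (h1.symm.trans h2)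
  · exact fun d => Metric.isOpen_ball.measurableSet

theorem volume_ball (x : Walsh) (n : ℤ) :
    volume (Metric.ball x ((3 : ℝ) ^ n)) = (3 : ℝ≥0∞) ^ n := by
  rw [Measure.addHaar_ball_center]
  induction n using Int.induction_on with
  | zero => simpa using volume_unitBall
  | succ n ih =>
    rw [volume_ball_succ, ih, ENNReal.zpow_add (by norm_num) (by norm_num), zpow_one, mul_comm]
  | pred n ih =>
    have h := volume_ball_succ (-(n : ℤ) - 1)
    rw [sub_add_cancel, ih] at h
    have h3 : (3 : ℝ≥0∞) ^ (-(n : ℤ)) = 3 * 3 ^ (-(n : ℤ) - 1) := by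
      conv_lhs => rw [show -(n : ℤ) = 1 + (-(n : ℤ) - 1) by ring]
      rw [ENNReal.zpow_add (by norm_num) (by norm_num), zpow_one]
    rw [h3] at h
    exact ((ENNReal.mul_right_inj (by norm_num) (by norm_num)).1 h).symm

/-- The Walsh exponential `exp_ξ(x) = (e^{2πi/3})^{∑_{j+k=-1} [ξ]_j [x]_k}` (a finite sum). -/
noncomputable def expo (ξ x : Walsh) : ℂ :=
  ZMod.stdAddChar (N := 3) (∑ᶠ j : ℤ, ξ.digit j * x.digit (-1 - j))

end Walsh

/-! ### Intervals, tiles, tritiles -/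

/-- An interval (Walsh ball) `B_{3^scale}(center)`, with its unique centre
whose digits below the scale vanish. -/
structure WInterval where
  scale : ℤ
  center : Walsh
  center_digit : ∀ j, j < scale → center.digit j = 0

namespace WInterval

/-- The interval as a subset of `𝕎`. -/
def toSet (I : WInterval) : Set Walsh := Metric.ball I.center ((3 : ℝ) ^ I.scale)

/-- The length `|I|`. -/
noncomputable def length (I : WInterval) : ℝ≥0 := (3 : ℝ≥0) ^ I.scale

/-- The length is the Haar measure. -/
theorem volume_toSet (I : WInterval) : volume I.toSet = I.length := by
  rw [toSet, Walsh.volume_ball, length, ENNReal.coe_zpow (by norm_num)]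
  rfl

/-- The child interval `ch_v(I) = {x ∈ I : [x]_{log_3 |I| - 1} = v}`. -/
def child (I : WInterval) (v : ZMod 3) : WInterval where
  scale := I.scale - 1
  center := I.center + Walsh.single (I.scale - 1) v
  center_digit j hj := by
    rw [Walsh.digit_add, Walsh.digit_single, I.center_digit j (by omega), if_neg (by omega),
      add_zero]

end WInterval

/-- A tile: a rectangle of area `1` whose sides are intervals. -/
structure Tile where
  time : WInterval
  freq : WInterval
  area : time.scale + freq.scale = 0

/-- The wave packet `w_P(x) = |I_P|⁻¹ exp_{ξ_P}(x) 1_{I_P}(x)`. -/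
noncomputable def Tile.wavePacket (P : Tile) : Walsh → ℂ :=
  P.time.toSet.indicator fun x => ((P.time.length : ℝ) : ℂ)⁻¹ * Walsh.expo P.freq.center x

/-- A tritile: a rectangle of area `3` whose sides are intervals. -/
structure Tritile where
  time : WInterval
  freq : WInterval
  area : time.scale + freq.scale = 1

namespace Tritile

/-- The tile `𝐏_v = I_𝐏 × ch_v(ω_𝐏)`. -/
def tile (P : Tritile) (v : Fin 3) : Tile where
  time := P.time
  freq := P.freq.child ((v : ℕ) : ZMod 3)
  area := by
    have := P.area
    simp only [WInterval.child]
    omega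

/-- The order on tritiles: `Q ≤ P` if `I_Q ⊆ I_P` and `ω_Q ⊇ ω_P`. -/
def below (Q P : Tritile) : Prop :=
  Q.time.toSet ⊆ P.time.toSet ∧ P.freq.toSet ⊆ Q.freq.toSet

/-- The tree with top `P`. -/
def tree (P : Tritile) : Set Tritile := {Q | Q.below P}

end Tritile

/-- The strip with top `I`. -/
def strip (I : WInterval) : Set Tritile := {P | P.time.toSet ⊆ I.toSet}

/-! ### Schwartz functions and the embedding -/

/-- Schwartz functions: for some `N > 0`, supported on `B_{3^N}(0)` and
constant on every interval of length `< 3^{-N}`. -/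
def IsWalshSchwartz {X : Type*} [Zero X] (f : Walsh → X) : Prop :=
  ∃ N : ℕ, 0 < N ∧
    (∀ x, x ∉ Metric.ball (0 : Walsh) ((3 : ℝ) ^ N) → f x = 0) ∧
    ∀ I : WInterval, I.length < (3 : ℝ≥0) ^ (-(N : ℤ)) →
      ∀ x ∈ I.toSet, ∀ y ∈ I.toSet, f x = f y

/-- The bilinear pairing `⟨f; g⟩ = ∫ f(x) g(x) dx ∈ X` (no complex conjugation). -/
noncomputable def walshPairing {X : Type*} [NormedAddCommGroup X] [NormedSpace ℂ X]
    (f : Walsh → X) (g : Walsh → ℂ) : X := ∫ x, g x • f x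

/-- The embedding `𝓔[f](𝐏) = (⟨f; w_{𝐏_u}⟩)_{u ∈ {0,1,2}} ∈ X³`;
`Fin 3 → X` carries the maximum norm. -/
noncomputable def walshEmbedding {X : Type*} [NormedAddCommGroup X] [NormedSpace ℂ X]
    (f : Walsh → X) (P : Tritile) : Fin 3 → X :=
  fun u => walshPairing f (P.tile u).wavePacket

/-! ### Outer structures and outer-`L^p` quasinorms -/

/-- The data that determine outer-`L^p` quasinorms of functions `F : α → V`:
an indexed family of generating sets, a premeasure, and a size. -/
structure OuterData (α V : Type*) where
  Index : Type
  gen : Index → Set α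
  premeasure : Index → ℝ≥0
  size : Index → (α → V) → ℝ≥0∞

namespace OuterData

variable {α V : Type*} [Zero V] (O : OuterData α V)

/-- The outer measure: infimum over countable covers by generating sets. -/
noncomputable def outerMeasure (A : Set α) : ℝ≥0∞ :=
  ⨅ (E : Set O.Index) (_ : E.Countable) (_ : A ⊆ ⋃ i ∈ E, O.gen i),
    ∑' i : E, (O.premeasure i : ℝ≥0∞)

/-- `‖F‖_S`, the supremum of the size over all generating sets. -/
noncomputable def supSize (F : α → V) : ℝ≥0∞ := ⨆ i, O.size i F

/-- The outer superlevel measure `σ(‖F‖_S > t)`: the infimum of `σ(A)` over all `A`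
with `‖1_{α ∖ A} F‖_S ≤ t`. -/
noncomputable def superlevel (F : α → V) (t : ℝ) : ℝ≥0∞ :=
  ⨅ (A : Set α) (_ : O.supSize (Aᶜ.indicator F) ≤ ENNReal.ofReal t), O.outerMeasure A

/-- The outer-`L^p` quasinorm for `p ∈ (0, ∞]`. -/
noncomputable def outerLp (p : ℝ≥0∞) (F : α → V) : ℝ≥0∞ :=
  if p = ∞ then O.supSize F
  else (∫⁻ t in Ioi (0 : ℝ),
    ENNReal.ofReal (p.toReal * t ^ (p.toReal - 1)) * O.superlevel F t) ^ (1 / p.toReal)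

end OuterData

/-- Trees, with premeasure `μ(T) = |I_T|` and size `‖F‖_{S^∞(T)} = sup_{P ∈ T} |F(P)|`.
Trees are indexed by their tops. -/
noncomputable def treeSInfty : OuterData Tritile ℂ where
  Index := Tritile
  gen := Tritile.tree
  premeasure P := P.time.length
  size P F := ⨆ Q ∈ P.tree, ‖F Q‖ₑ

/-- The iterated structure: strips, with premeasure `ν(D) = |I_D|` and size
`|I_D|^{-1/q} ‖1_D F‖_{L^q_μ S^∞}` (for `q = ∞` the exponent is `0`).
Strips are indexed by their tops. -/
noncomputable def stripLqSInfty (q : ℝ≥0∞) : OuterData Tritile ℂ where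
  Index := WInterval
  gen := strip
  premeasure I := I.length
  size I F := (I.length : ℝ≥0∞) ^ (-(q⁻¹).toReal) *
    treeSInfty.outerLp q ((strip I).indicator F)

/-! ### Complex interpolation and `r`-Hilbertian spaces -/

/-- The functions of the complex interpolation method for the couple `(H, Y)`: `V` is the sum
space `H + Y`, and `iH`, `iY` are the inclusions. Bounded continuous functions on the closed strip
`0 ≤ Re z ≤ 1` with values in `V`, holomorphic inside, whose boundary values are bounded continuous
functions into `H` (on `Re z = 0`) and into `Y` (on `Re z = 1`). -/
structure CalderonFunction {H Y V : Type*}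
    [NormedAddCommGroup H] [NormedSpace ℂ H] [NormedAddCommGroup Y] [NormedSpace ℂ Y]
    [NormedAddCommGroup V] [NormedSpace ℂ V] (iH : H →L[ℂ] V) (iY : Y →L[ℂ] V) where
  toFun : ℂ → V
  left : ℝ →ᵇ H
  right : ℝ →ᵇ Y
  continuousOn : ContinuousOn toFun {z | z.re ∈ Icc (0 : ℝ) 1}
  bounded : ∃ M : ℝ, ∀ z : ℂ, z.re ∈ Icc (0 : ℝ) 1 → ‖toFun z‖ ≤ M
  holomorphic : DifferentiableOn ℂ toFun {z | z.re ∈ Ioo (0 : ℝ) 1}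
  left_eq : ∀ t : ℝ, toFun (t * Complex.I) = iH (left t)
  right_eq : ∀ t : ℝ, toFun (1 + t * Complex.I) = iY (right t)

/-- The norm of the complex interpolation space `[H, Y]_θ`, as an extended-valued function on
`H + Y`; the value is `∞` exactly outside `[H, Y]_θ`. -/
noncomputable def interpNorm {H Y V : Type*}
    [NormedAddCommGroup H] [NormedSpace ℂ H] [NormedAddCommGroup Y] [NormedSpace ℂ Y]
    [NormedAddCommGroup V] [NormedSpace ℂ V] (iH : H →L[ℂ] V) (iY : Y →L[ℂ] V)
    (θ : ℝ) (v : V) : ℝ≥0∞ :=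
  ⨅ (F : CalderonFunction iH iY) (_ : F.toFun (θ : ℂ) = v),
    ENNReal.ofReal (max ‖F.left‖ ‖F.right‖)

/-- `X` is `r`-Hilbertian: there are a Hilbert space `H` and a Banach space `Y` forming an
interpolation couple, such that `X` is isomorphic to `[H, Y]_θ`, where `1 / r = (1 - θ) / 2`.

The couple is given by its sum space: a Banach space `V` with continuous injections of `H` and `Y`
whose ranges span `V`. (By the open mapping theorem the norm of such a `V` is equivalent to the
norm of `H + Y`.) The isomorphism is a linear map from `X` onto `[H, Y]_θ ⊆ V` that is bounded
above and below for the interpolation norm. -/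
def IsRHilbertian (r : ℝ) (X : Type u) [NormedAddCommGroup X] [NormedSpace ℂ X] : Prop :=
  ∃ (H : Type v) (_ : NormedAddCommGroup H) (_ : InnerProductSpace ℂ H) (_ : CompleteSpace H)
    (Y : Type v) (_ : NormedAddCommGroup Y) (_ : NormedSpace ℂ Y) (_ : CompleteSpace Y)
    (V : Type v) (_ : NormedAddCommGroup V) (_ : NormedSpace ℂ V) (_ : CompleteSpace V)
    (iH : H →L[ℂ] V) (iY : Y →L[ℂ] V) (θ : ℝ) (J : X →ₗ[ℂ] V) (K : ℝ≥0),
    Function.Injective iH ∧ Function.Injective iY ∧ (∀ v : V, ∃ h y, v = iH h + iY y) ∧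
    θ ∈ Icc (0 : ℝ) 1 ∧ 1 / r = (1 - θ) / 2 ∧
    range J = {v | interpNorm iH iY θ v < ∞} ∧
    ∀ x : X, interpNorm iH iY θ (J x) ≤ K * ‖x‖ₑ ∧ ‖x‖ₑ ≤ K * interpNorm iH iY θ (J x)

/-! The core is a weak tile-type inequality, `IsRHilbertian.exists_tile_bound`: if the tiles of a
finite family are disjoint and every coefficient `⟨f; w_P⟩` has norm at least `τ`, then `τ ^ r * ∑
|I_P| ≤ C * ‖f‖_r ^ r`. It interpolates between two elementary facts: Bessel's inequality with
values in `H`, which follows from the orthogonality of wave packets of disjoint tiles, and the bound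
`‖⟨f; w_P⟩‖ ≤ ‖f‖_∞` in `Y`.

The interpolation is carried out inside the complex method. Each value `v` of a simple function `f`
is replaced by a nearly optimal Calderón function, times a scalar power of `‖v‖`. The left boundary
values then have norm at most `k * ‖f‖ ^ (r / 2)` in `H`, and the right ones at most `k` in `Y`.
Pairing with `w_P` gives a Calderón function through the coefficient at `θ`. Bessel's inequality
controls its left boundary only after summation over `P`, for each fixed `t`, so a uniform bound on
that boundary is not available for an individual `P`. What is needed is `exists_boundary_measure`: a
square mean on the left with respect to a fixed finite measure, together with a uniform bound on the
right, controls the interpolation norm. For `0 < θ < 1` this is a three lines argument with an outer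
function that absorbs the peaks of the left boundary values. A large coefficient thus forces a large
square mean, and integrating Bessel's inequality in `t` finishes the proof.

A set of tritiles with large coefficients is covered by the trees of its maximal members, which are
disjoint, so the tile inequality bounds its outer measure (`treeSInfty_outerMeasure_mul_le`).

For the embedding, fix `1 < s < min p r` close to `min p r`. At level `l`, remove the tritiles over
intervals where the mean of `‖f‖ ^ s` exceeds `l ^ s`; their strips cost no more than in the dyadic
maximal theorem. On what remains of a strip, truncate `f` at a height depending on `τ`: the high
part changes coefficients by at most `τ / 2`, and the low part enters the tile inequality. This
gives a weak-type bound of exponent `s' * (r - 1) = s * (r - 1) / (s - 1)`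
(`outerMeasure_level_le`). The hypothesis on `q` lets `s` be chosen with this exponent below `q`, so
the averaged `L^q` size is `O(l)`. Integrating the maximal estimate in `l`, which uses `s < p`,
gives the theorem. -/

/-! ### Geometry of intervals and tiles -/

namespace WInterval

theorem mem_toSet_iff (I : WInterval) (x : Walsh) :
    x ∈ I.toSet ↔ ∀ j, I.scale ≤ j → x.digit j = I.center.digit j :=
  Walsh.mem_ball_iff _ _ _

theorem center_mem (I : WInterval) : I.center ∈ I.toSet :=
  (I.mem_toSet_iff _).2 fun _ _ => rfl

theorem measurableSet_toSet (I : WInterval) : MeasurableSet I.toSet :=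
  Metric.isOpen_ball.measurableSet

theorem length_pos (I : WInterval) : 0 < I.length := by
  unfold length; positivity

theorem volume_toSet_ne_top (I : WInterval) : volume I.toSet ≠ ∞ := by
  rw [volume_toSet]; exact ENNReal.coe_ne_top

theorem subset_of_mem {I J : WInterval} (h : I.scale ≤ J.scale) {x : Walsh}
    (hI : x ∈ I.toSet) (hJ : x ∈ J.toSet) : I.toSet ⊆ J.toSet := by
  intro y hy
  rw [mem_toSet_iff] at *
  intro j hj
  rw [hy j (h.trans hj), ← hI j (h.trans hj), hJ j hj]

theorem ext_of_mem {I J : WInterval} (h : I.scale = J.scale) {x : Walsh}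
    (hI : x ∈ I.toSet) (hJ : x ∈ J.toSet) : I = J := by
  rw [mem_toSet_iff] at *
  have hc : I.center = J.center := by
    refine Walsh.ext_digit fun j => ?_
    by_cases hj : I.scale ≤ j
    · rw [← hI j hj, hJ j (h ▸ hj)]
    · rw [I.center_digit j (by omega), J.center_digit j (by omega)]
  cases I; cases J; simp_all

theorem scale_le_of_subset {I J : WInterval} (h : I.toSet ⊆ J.toSet) : I.scale ≤ J.scale := by
  have h1 := measure_mono (μ := volume) h
  rw [volume_toSet, volume_toSet, ENNReal.coe_le_coe, length, length] at h1
  exact (zpow_le_zpow_iff_right₀ (by norm_num)).1 h1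

theorem subset_or_disjoint {I J : WInterval} (h : I.scale ≤ J.scale) :
    I.toSet ⊆ J.toSet ∨ Disjoint I.toSet J.toSet := by
  by_cases hd : Disjoint I.toSet J.toSet
  · exact Or.inr hd
  · obtain ⟨x, hI, hJ⟩ := Set.not_disjoint_iff.1 hd
    exact Or.inl (subset_of_mem h hI hJ)

theorem child_subset (I : WInterval) (v : ZMod 3) : (I.child v).toSet ⊆ I.toSet := by
  intro x hx
  rw [mem_toSet_iff] at *
  intro j hj
  rw [hx j (by simp only [child]; omega)]
  simp only [child, Walsh.digit_add, Walsh.digit_single]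
  rw [if_neg (by omega), add_zero]

/-- A normalised centre has only finitely many nonzero digits. Countability is what makes families
of maximal intervals or tritiles admissible as covers in `outerMeasure`. -/
instance : Countable WInterval := by
  have hfin : ∀ I : WInterval, (Function.support I.center.digit).Finite := by
    intro I
    obtain ⟨N, hN⟩ := I.center.2
    refine (Set.finite_Icc I.scale N).subset fun j hj => ⟨?_, ?_⟩
    · by_contra h
      exact hj (I.center_digit j (by omega))
    · by_contra h
      exact hj (hN j (by omega))
  let φ : WInterval → ℤ × (ℤ →₀ ZMod 3) := fun I =>
    (I.scale, Finsupp.ofSupportFinite I.center.digit (hfin I))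
  refine Function.Injective.countable (f := φ) fun I J h => ?_
  have h1 : I.scale = J.scale := congrArg Prod.fst h
  have h2 : I.center = J.center := by
    refine Walsh.ext_digit fun j => ?_
    exact DFunLike.congr_fun (congrArg Prod.snd h) j
  cases I; cases J; simp_all

/-- The interval of a given scale that contains a given point. -/
theorem exists_mem_toSet (x : Walsh) (n : ℤ) : ∃ I : WInterval, I.scale = n ∧ x ∈ I.toSet := by
  obtain ⟨N, hN⟩ := x.2
  refine ⟨⟨n, ⟨fun j => if j < n then 0 else x.digit j, N, fun j hj => ?_⟩, fun j hj => if_pos hj⟩,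
    rfl, ?_⟩
  · change (if j < n then 0 else x.digit j) = 0
    split_ifs
    · rfl
    · exact hN j hj
  · rw [mem_toSet_iff]
    intro j hj
    exact (if_neg (not_lt.2 hj)).symm

end WInterval

namespace Tile

/-- A tile as a subset of the phase plane. -/
def toSet (P : Tile) : Set (Walsh × Walsh) := P.time.toSet ×ˢ P.freq.toSet

end Tile

namespace Tritile

theorem ext_parts {P Q : Tritile} (h1 : P.time = Q.time) (h2 : P.freq = Q.freq) : P = Q := by
  cases P; cases Q; simp_all

theorem below_refl (P : Tritile) : P.below P := ⟨subset_rfl, subset_rfl⟩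

theorem below_trans {P Q R : Tritile} (h : P.below Q) (h' : Q.below R) : P.below R :=
  ⟨h.1.trans h'.1, h'.2.trans h.2⟩

theorem tile_toSet_subset (P : Tritile) (u : Fin 3) :
    (P.tile u).toSet ⊆ P.time.toSet ×ˢ P.freq.toSet :=
  Set.prod_mono subset_rfl (WInterval.child_subset _ _)

/-- Intervals are nested or disjoint, and the area is fixed: a longer time interval means a shorter
frequency interval. Overlapping tritiles are therefore always comparable. -/
theorem below_of_not_disjoint {P Q : Tritile}
    (h : ¬ Disjoint (P.time.toSet ×ˢ P.freq.toSet) (Q.time.toSet ×ˢ Q.freq.toSet))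
    (hs : P.time.scale ≤ Q.time.scale) : P.below Q := by
  obtain ⟨z, hP, hQ⟩ := Set.not_disjoint_iff.1 h
  have h1 := P.area
  have h2 := Q.area
  exact ⟨WInterval.subset_of_mem hs hP.1 hQ.1, WInterval.subset_of_mem (by omega) hQ.2 hP.2⟩

theorem eq_of_not_disjoint {P Q : Tritile}
    (h : ¬ Disjoint (P.time.toSet ×ˢ P.freq.toSet) (Q.time.toSet ×ˢ Q.freq.toSet))
    (hs : P.time.scale = Q.time.scale) : P = Q := by
  obtain ⟨z, hP, hQ⟩ := Set.not_disjoint_iff.1 h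
  have h1 := P.area
  have h2 := Q.area
  exact ext_parts (WInterval.ext_of_mem hs hP.1 hQ.1)
    (WInterval.ext_of_mem (by omega) hP.2 hQ.2)

instance : Countable Tritile := by
  refine Function.Injective.countable (f := fun P : Tritile => (P.time, P.freq)) fun P Q h => ?_
  exact ext_parts (congrArg Prod.fst h) (congrArg Prod.snd h)

end Tritile

/-! ### Walsh exponentials -/

namespace Walsh

theorem finite_support_mul (ξ x : Walsh) :
    (Function.support fun j : ℤ => ξ.digit j * x.digit (-1 - j)).Finite := by
  obtain ⟨N, hN⟩ := ξ.2
  obtain ⟨M, hM⟩ := x.2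
  refine (Set.finite_Icc (-1 - M) N).subset fun j hj => ⟨?_, ?_⟩
  · by_contra h
    refine hj ?_
    have : x.digit (-1 - j) = 0 := hM _ (by omega)
    simp [this]
  · by_contra h
    refine hj ?_
    have : ξ.digit j = 0 := hN _ (by omega)
    simp [this]

theorem expo_add_right (ξ x y : Walsh) : expo ξ (x + y) = expo ξ x * expo ξ y := by
  simp only [expo, digit_add, mul_add]
  rw [finsum_add_distrib (finite_support_mul ξ x) (finite_support_mul ξ y), AddChar.map_add_eq_mul]

theorem expo_add_left (ξ η x : Walsh) : expo (ξ + η) x = expo ξ x * expo η x := by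
  simp only [expo, digit_add, add_mul]
  rw [finsum_add_distrib (finite_support_mul ξ x) (finite_support_mul η x), AddChar.map_add_eq_mul]

theorem norm_expo (ξ x : Walsh) : ‖expo ξ x‖ = 1 := by
  rw [expo, ZMod.stdAddChar_apply]
  exact Circle.norm_coe _

theorem expo_neg_left (ξ x : Walsh) : expo (-ξ) x = (starRingEnd ℂ) (expo ξ x) := by
  have h : expo (-ξ) x = (expo ξ x)⁻¹ := by
    simp only [expo, digit_neg, neg_mul, finsum_neg_distrib]
    exact AddChar.map_neg_eq_inv _ _
  rw [h, Complex.inv_def, Complex.normSq_eq_norm_sq, norm_expo]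
  simp

theorem expo_eq_one {ξ x : Walsh} {n : ℤ} (hξ : ∀ j, n ≤ j → ξ.digit j = 0)
    (hx : ∀ j, -n ≤ j → x.digit j = 0) : expo ξ x = 1 := by
  have : ∀ j : ℤ, ξ.digit j * x.digit (-1 - j) = 0 := by
    intro j
    by_cases hj : n ≤ j
    · rw [hξ j hj, zero_mul]
    · rw [hx _ (by omega), mul_zero]
  simp [expo, this]

theorem expo_single {ξ : Walsh} {n : ℤ} (d : ZMod 3) :
    expo ξ (single (-1 - n) d) = ZMod.stdAddChar (N := 3) (ξ.digit n * d) := by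
  rw [expo, finsum_eq_single _ n]
  · simp [digit_single]
  · intro j hj
    rw [digit_single, if_neg (by omega), mul_zero]

theorem continuous_expo (ξ : Walsh) : Continuous (expo ξ) := by
  obtain ⟨N, hN⟩ := ξ.2
  rw [continuous_iff_continuousAt]
  intro y
  refine ContinuousAt.congr (continuousAt_const (y := expo ξ y)) ?_
  filter_upwards [Metric.ball_mem_nhds y (show (0 : ℝ) < 3 ^ (-N) by positivity)] with x hx
  rw [mem_ball_iff] at hx
  have h : expo ξ (x - y) = 1 := expo_eq_one hN fun j hj => by
    rw [digit_sub, hx j hj, sub_self]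
  have h2 := expo_add_right ξ (x - y) y
  rw [sub_add_cancel, h, one_mul] at h2
  exact h2.symm

/-- A character that is nontrivial on `I - I` has mean zero on `I`. -/
theorem setIntegral_expo_eq_zero (I : WInterval) (ξ : Walsh) {n : ℤ} (hn : -I.scale ≤ n)
    (hξ : ξ.digit n ≠ 0) : ∫ x in I.toSet, expo ξ x = 0 := by
  -- Translation by `h` changes a digit below the scale of `I`, so it preserves `I`; it multiplies
  -- the character by `expo ξ h ≠ 1`.
  set h : Walsh := single (-1 - n) 1
  have h1 : expo ξ h ≠ 1 := by
    rw [expo_single, mul_one]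
    intro hh
    refine hξ (ZMod.injective_stdAddChar (N := 3) ?_)
    rw [hh, AddChar.map_zero_eq_one]
  have h2 : ∀ x, x + h ∈ I.toSet ↔ x ∈ I.toSet := by
    intro x
    simp only [WInterval.mem_toSet_iff, digit_add, h, digit_single]
    refine forall₂_congr fun j hj => ?_
    rw [if_neg (by omega), add_zero]
  have h3 : ∫ x in I.toSet, expo ξ x = expo ξ h * ∫ x in I.toSet, expo ξ x := by
    rw [← integral_indicator I.measurableSet_toSet]
    conv_lhs => rw [← integral_add_right_eq_self _ h]
    rw [← integral_const_mul]
    refine integral_congr_ae (Eventually.of_forall fun x => ?_)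
    by_cases hx : x ∈ I.toSet
    · simp only [indicator_of_mem hx, indicator_of_mem ((h2 x).2 hx), expo_add_right]
      ring
    · simp only [indicator_of_notMem hx, indicator_of_notMem (fun hh => hx ((h2 x).1 hh)), mul_zero]
  have h4 : (1 - expo ξ h) * ∫ x in I.toSet, expo ξ x = 0 := by
    rw [sub_mul, one_mul, ← h3, sub_self]
  exact (mul_eq_zero.1 h4).resolve_left (sub_ne_zero.2 (Ne.symm h1))

end Walsh

/-! ### Wave packets -/

namespace Tile

theorem measurable_wavePacket (P : Tile) : Measurable P.wavePacket :=
  ((Walsh.continuous_expo _).measurable.const_mul _).indicator P.time.measurableSet_toSet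

theorem norm_wavePacket (P : Tile) (x : Walsh) :
    ‖P.wavePacket x‖ = P.time.toSet.indicator (fun _ => (P.time.length : ℝ)⁻¹) x := by
  unfold wavePacket
  by_cases hx : x ∈ P.time.toSet
  · simp [indicator_of_mem hx, Walsh.norm_expo]
  · simp [indicator_of_notMem hx]

theorem norm_wavePacket_le (P : Tile) (x : Walsh) :
    ‖P.wavePacket x‖ ≤ (P.time.length : ℝ)⁻¹ := by
  rw [norm_wavePacket]
  exact indicator_le_self' (fun _ _ => by positivity) x

theorem enorm_wavePacket (P : Tile) (x : Walsh) :
    ‖P.wavePacket x‖ₑ = P.time.toSet.indicator (fun _ => (P.time.length : ℝ≥0∞)⁻¹) x := by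
  rw [← ofReal_norm, norm_wavePacket]
  by_cases hx : x ∈ P.time.toSet
  · simp only [indicator_of_mem hx]
    rw [ENNReal.ofReal_inv_of_pos (by exact_mod_cast P.time.length_pos), ENNReal.ofReal_coe_nnreal]
  · simp [indicator_of_notMem hx]

theorem integrable_wavePacket (P : Tile) : Integrable P.wavePacket := by
  refine Integrable.mono' (g := P.time.toSet.indicator fun _ => (P.time.length : ℝ)⁻¹) ?_
    P.measurable_wavePacket.aestronglyMeasurable
    (Eventually.of_forall fun x => (P.norm_wavePacket x).le)
  exact (integrable_indicator_iff P.time.measurableSet_toSet).2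
    (integrableOn_const P.time.volume_toSet_ne_top)

theorem integral_norm_wavePacket (P : Tile) : ∫ x, ‖P.wavePacket x‖ = 1 := by
  simp only [norm_wavePacket]
  rw [integral_indicator P.time.measurableSet_toSet, setIntegral_const, Measure.real,
    WInterval.volume_toSet, ENNReal.coe_toReal, smul_eq_mul, mul_inv_cancel₀]
  exact_mod_cast P.time.length_pos.ne'

/-- Wave packets are normalised in `L^1`, so the squared `L^2` norm is `|I_P|⁻¹`; this is the source
of the weights `|I_P|` in Bessel's inequality. -/
theorem integral_wavePacket_mul_conj_self (P : Tile) :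
    ∫ x, P.wavePacket x * (starRingEnd ℂ) (P.wavePacket x) = ((P.time.length : ℝ)⁻¹ : ℝ) := by
  simp only [Complex.mul_conj, Complex.normSq_eq_norm_sq]
  rw [integral_complex_ofReal]
  congr 1
  have : ∀ x, ‖P.wavePacket x‖ ^ 2 = (P.time.length : ℝ)⁻¹ * ‖P.wavePacket x‖ := by
    intro x
    rw [norm_wavePacket]
    by_cases hx : x ∈ P.time.toSet
    · simp only [indicator_of_mem hx]; ring
    · simp [indicator_of_notMem hx]
  simp only [this]
  rw [integral_const_mul, integral_norm_wavePacket, mul_one]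

theorem integral_wavePacket_mul_conj_of_le {P Q : Tile} (h : Disjoint P.toSet Q.toSet)
    (hs : P.time.scale ≤ Q.time.scale) :
    ∫ x, P.wavePacket x * (starRingEnd ℂ) (Q.wavePacket x) = 0 := by
  have hP := P.area
  have hQ := Q.area
  rcases WInterval.subset_or_disjoint hs with h1 | h1
  · have h2 : Disjoint Q.freq.toSet P.freq.toSet := by
      rw [toSet, toSet, Set.disjoint_prod] at h
      rcases h with h | h
      · exact absurd (h1 P.time.center_mem) (Set.disjoint_left.1 h P.time.center_mem)
      · exact h.symm
    -- Nested time intervals force disjoint frequency intervals. The frequency centres then differ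
    -- in a digit at or above `P.freq.scale = -P.time.scale`, and the product is a multiple of a
    -- character of mean zero on `I_P`.
    obtain ⟨n, hn, hd⟩ : ∃ n, P.freq.scale ≤ n ∧
        (P.freq.center - Q.freq.center).digit n ≠ 0 := by
      by_contra! hcon
      refine Set.disjoint_left.1 h2 Q.freq.center_mem ((WInterval.mem_toSet_iff _ _).2 ?_)
      intro j hj
      have := hcon j hj
      rw [Walsh.digit_sub, sub_eq_zero] at this
      exact this.symm
    have h3 := Walsh.setIntegral_expo_eq_zero P.time _ (n := n) (by omega) hd
    have h4 : ∀ x, P.wavePacket x * (starRingEnd ℂ) (Q.wavePacket x) =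
        P.time.toSet.indicator (fun x =>
          (((P.time.length : ℝ) : ℂ)⁻¹ * ((Q.time.length : ℝ) : ℂ)⁻¹) *
            Walsh.expo (P.freq.center - Q.freq.center) x) x := by
      intro x
      unfold wavePacket
      by_cases hx : x ∈ P.time.toSet
      · simp only [indicator_of_mem hx, indicator_of_mem (h1 hx)]
        rw [sub_eq_add_neg, Walsh.expo_add_left, Walsh.expo_neg_left]
        simp only [map_mul, map_inv₀, Complex.conj_ofReal]
        ring
      · simp [indicator_of_notMem hx]
    simp only [h4]
    rw [integral_indicator P.time.measurableSet_toSet, integral_const_mul, h3, mul_zero]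
  · have h4 : ∀ x, P.wavePacket x * (starRingEnd ℂ) (Q.wavePacket x) = 0 := by
      intro x
      unfold wavePacket
      by_cases hx : x ∈ P.time.toSet
      · simp [indicator_of_notMem (Set.disjoint_left.1 h1 hx)]
      · simp [indicator_of_notMem hx]
    simp [h4]

/-- Wave packets of disjoint tiles are orthogonal. -/
theorem integral_wavePacket_mul_conj {P Q : Tile} (h : Disjoint P.toSet Q.toSet) :
    ∫ x, P.wavePacket x * (starRingEnd ℂ) (Q.wavePacket x) = 0 := by
  rcases le_total P.time.scale Q.time.scale with hs | hs
  · exact integral_wavePacket_mul_conj_of_le h hs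
  · have h1 := integral_wavePacket_mul_conj_of_le h.symm hs
    have h2 := integral_conj (μ := volume)
      (f := fun x => Q.wavePacket x * (starRingEnd ℂ) (P.wavePacket x))
    rw [h1, map_zero] at h2
    rw [← h2]
    refine integral_congr_ae (Eventually.of_forall fun x => ?_)
    simp [mul_comm]

end Tile

/-! ### A vector-valued Bessel inequality -/

/-- With `g` the orthogonal expansion of `f` along the `w i`, expand `0 ≤ ∫ ‖g - f‖ ^ 2`; both `⟨g,
g⟩` and `⟨g, f⟩` equal the left side. -/
theorem vector_bessel_inequality {α ι H : Type*} [MeasurableSpace α] {μ : Measure α}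
    [NormedAddCommGroup H] [InnerProductSpace ℂ H] [CompleteSpace H]
    (s : Finset ι) (w : ι → α → ℂ) (l : ι → ℝ) (hl : ∀ i ∈ s, 0 < l i)
    (hw : ∀ i ∈ s, MemLp (w i) 2 μ)
    (hself : ∀ i ∈ s, ∫ x, w i x * (starRingEnd ℂ) (w i x) ∂μ = ((l i)⁻¹ : ℝ))
    (horth : ∀ i ∈ s, ∀ j ∈ s, i ≠ j → ∫ x, w i x * (starRingEnd ℂ) (w j x) ∂μ = 0)
    (f : α → H) (hf : MemLp f 2 μ) :
    ∑ i ∈ s, l i * ‖∫ x, w i x • f x ∂μ‖ ^ 2 ≤ ∫ x, ‖f x‖ ^ 2 ∂μ := by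
  classical
  set c : ι → H := fun i => ∫ x, w i x • f x ∂μ with hc
  set e : ι → α → H := fun i x => (starRingEnd ℂ) (w i x) • ((l i : ℂ) • c i) with he
  have hwc : ∀ i ∈ s, MemLp (fun x => (starRingEnd ℂ) (w i x)) 2 μ := fun i hi => by
    exact (hw i hi).star
  have heL : ∀ i ∈ s, MemLp (e i) 2 μ := fun i hi => by
    have := (ContinuousLinearMap.toSpanSingleton ℂ ((l i : ℂ) • c i)).comp_memLp' (hwc i hi)
    exact this
  set g : α → H := fun x => ∑ i ∈ s, e i x with hg
  have hgL : MemLp g 2 μ := memLp_finsetSum s heL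
  have hin : ∀ {a b : α → H}, MemLp a 2 μ → MemLp b 2 μ →
      Integrable (fun x => inner ℂ (a x) (b x)) μ := fun ha hb => by
    have := L2.integrable_inner (𝕜 := ℂ) ha.toLp hb.toLp
    refine this.congr ?_
    filter_upwards [ha.coeFn_toLp, hb.coeFn_toLp] with x h1 h2
    rw [h1, h2]
  have h1 : ∀ i ∈ s, ∫ x, inner ℂ (e i x) (f x) ∂μ = ((l i * ‖c i‖ ^ 2 : ℝ) : ℂ) := by
    intro i hi
    have hint : Integrable (fun x => w i x • f x) μ := by
      have := (hf.smul (hw i hi) (r := 1))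
      exact memLp_one_iff_integrable.1 this
    have : ∀ x, inner ℂ (e i x) (f x) = (l i : ℂ) * inner ℂ (c i) (w i x • f x) := by
      intro x
      simp only [he, inner_smul_left, inner_smul_right, RingHomCompTriple.comp_apply,
        RingHom.id_apply, Complex.conj_ofReal]
      ring
    simp only [this]
    rw [integral_const_mul, integral_inner hint, inner_self_eq_norm_sq_to_K]
    push_cast
    rfl
  have h2 : ∀ i ∈ s, ∀ j ∈ s, ∫ x, inner ℂ (e i x) (e j x) ∂μ =
      if i = j then ((l i * ‖c i‖ ^ 2 : ℝ) : ℂ) else 0 := by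
    intro i hi j hj
    have : ∀ x, inner ℂ (e i x) (e j x) =
        ((l i : ℂ) * l j * inner ℂ (c i) (c j)) * (w i x * (starRingEnd ℂ) (w j x)) := by
      intro x
      simp only [he, inner_smul_left, inner_smul_right, RingHomCompTriple.comp_apply,
        RingHom.id_apply, Complex.conj_ofReal]
      ring
    simp only [this]
    rw [integral_const_mul]
    split_ifs with hij
    · subst hij
      rw [hself i hi, inner_self_eq_norm_sq_to_K]
      have : (l i : ℂ) ≠ 0 := by exact_mod_cast (hl i hi).ne'
      push_cast
      field_simp
      rfl
    · rw [horth i hi j hj hij, mul_zero]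
  set S : ℝ := ∑ i ∈ s, l i * ‖c i‖ ^ 2 with hS
  have hgf : ∫ x, inner ℂ (g x) (f x) ∂μ = (S : ℂ) := by
    simp only [hg, sum_inner]
    rw [integral_finsetSum s fun i hi => hin (heL i hi) hf, Finset.sum_congr rfl h1, hS]
    push_cast
    rfl
  have hgg : ∫ x, inner ℂ (g x) (g x) ∂μ = (S : ℂ) := by
    simp only [hg, sum_inner, inner_sum]
    rw [integral_finsetSum s fun j hj => integrable_finsetSum s fun i hi =>
      hin (heL i hi) (heL j hj)]
    have : ∀ j ∈ s, ∫ x, ∑ i ∈ s, inner ℂ (e i x) (e j x) ∂μ = ((l j * ‖c j‖ ^ 2 : ℝ) : ℂ) := by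
      intro j hj
      rw [integral_finsetSum s fun i hi => hin (heL i hi) (heL j hj),
        Finset.sum_congr rfl fun i hi => h2 i hi j hj, Finset.sum_ite_eq' s j, if_pos hj]
    rw [Finset.sum_congr rfl this, hS]
    push_cast
    rfl
  have hre : ∀ {a b : α → H}, MemLp a 2 μ → MemLp b 2 μ →
      ∫ x, (inner ℂ (a x) (b x)).re ∂μ = (∫ x, inner ℂ (a x) (b x) ∂μ).re := fun ha hb =>
    integral_re (hin ha hb)
  have hnn : 0 ≤ ∫ x, ‖g x - f x‖ ^ 2 ∂μ := integral_nonneg fun x => by positivity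
  have hexp : ∀ x, ‖g x - f x‖ ^ 2 =
      (inner ℂ (g x) (g x)).re - 2 * (inner ℂ (g x) (f x)).re + (inner ℂ (f x) (f x)).re := by
    intro x
    have ha := norm_sub_sq (𝕜 := ℂ) (g x) (f x)
    have hb := inner_self_eq_norm_sq (𝕜 := ℂ) (g x)
    have hc := inner_self_eq_norm_sq (𝕜 := ℂ) (f x)
    simp only [RCLike.re_eq_complex_re] at ha hb hc
    rw [ha, hb, hc]
  have hff : ∫ x, ‖f x‖ ^ 2 ∂μ = ∫ x, (inner ℂ (f x) (f x)).re ∂μ := by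
    refine integral_congr_ae (Eventually.of_forall fun x => ?_)
    exact (inner_self_eq_norm_sq (𝕜 := ℂ) (f x)).symm
  simp only [hexp] at hnn
  have i1 : Integrable (fun x => (inner ℂ (g x) (g x)).re) μ := (hin hgL hgL).re
  have i2 : Integrable (fun x => (inner ℂ (g x) (f x)).re) μ := (hin hgL hf).re
  have i3 : Integrable (fun x => (inner ℂ (f x) (f x)).re) μ := (hin hf hf).re
  have i4 : Integrable (fun x => (inner ℂ (g x) (g x)).re - 2 * (inner ℂ (g x) (f x)).re) μ :=
    i1.sub (i2.const_mul 2)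
  rw [integral_add i4 i3, integral_sub i1 (i2.const_mul 2),
    integral_const_mul, hre hgL hgL, hre hgL hf, hgg, hgf, ← hff] at hnn
  simp only [Complex.ofReal_re] at hnn
  change S ≤ _
  linarith

/-! ### Multipliers and the complex interpolation norm -/

/-- Scalar functions that are bounded on the closed strip and holomorphic near it. -/
structure IsStripMultiplier (g : ℂ → ℂ) : Prop where
  differentiableAt : ∀ z : ℂ, z.re ∈ Icc (0 : ℝ) 1 → DifferentiableAt ℂ g z
  bounded : ∃ M : ℝ, ∀ z : ℂ, z.re ∈ Icc (0 : ℝ) 1 → ‖g z‖ ≤ M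

namespace IsStripMultiplier

theorem continuousOn {g : ℂ → ℂ} (hg : IsStripMultiplier g) :
    ContinuousOn g {z | z.re ∈ Icc (0 : ℝ) 1} :=
  fun z hz => (hg.differentiableAt z hz).continuousAt.continuousWithinAt

theorem const_mul {g : ℂ → ℂ} (hg : IsStripMultiplier g) (c : ℂ) :
    IsStripMultiplier fun z => c * g z := by
  obtain ⟨M, hM⟩ := hg.bounded
  refine ⟨fun z hz => (hg.differentiableAt z hz).const_mul c, ‖c‖ * M, fun z hz => ?_⟩
  rw [norm_mul]
  exact mul_le_mul_of_nonneg_left (hM z hz) (norm_nonneg c)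

theorem continuous_comp {g : ℂ → ℂ} (hg : IsStripMultiplier g) {φ : ℝ → ℂ}
    (hφ : Continuous φ) (h : ∀ t, (φ t).re ∈ Icc (0 : ℝ) 1) : Continuous fun t => g (φ t) :=
  hg.continuousOn.comp_continuous hφ h

/-- Exponentials whose exponent has real part bounded above. -/
theorem exp {φ : ℂ → ℂ} (h : ∀ z : ℂ, z.re ∈ Icc (0 : ℝ) 1 → DifferentiableAt ℂ φ z) {M : ℝ}
    (hM : ∀ z : ℂ, z.re ∈ Icc (0 : ℝ) 1 → (φ z).re ≤ M) :
    IsStripMultiplier fun z => Complex.exp (φ z) := by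
  refine ⟨fun z hz => (h z hz).cexp, Real.exp M, fun z hz => ?_⟩
  rw [Complex.norm_exp]
  exact Real.exp_le_exp.2 (hM z hz)

end IsStripMultiplier

theorem re_ofReal_mul_I_mem (t : ℝ) : ((t : ℂ) * Complex.I).re ∈ Icc (0 : ℝ) 1 := by
  simp

theorem re_one_add_ofReal_mul_I_mem (t : ℝ) :
    ((1 : ℂ) + (t : ℂ) * Complex.I).re ∈ Icc (0 : ℝ) 1 := by
  simp

namespace CalderonFunction

variable {H Y V : Type*}
    [NormedAddCommGroup H] [NormedSpace ℂ H] [NormedAddCommGroup Y] [NormedSpace ℂ Y]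
    [NormedAddCommGroup V] [NormedSpace ℂ V] {iH : H →L[ℂ] V} {iY : Y →L[ℂ] V}

/-- The combination `∑ g_i F_i` of Calderón functions with multipliers as coefficients. -/
noncomputable def combination {ι : Type*} (s : Finset ι) (g : ι → ℂ → ℂ)
    (hg : ∀ i, IsStripMultiplier (g i)) (F : ι → CalderonFunction iH iY) :
    CalderonFunction iH iY where
  toFun z := ∑ i ∈ s, g i z • (F i).toFun z
  left := ∑ i ∈ s, BoundedContinuousFunction.ofNormedAddCommGroup
    (fun t : ℝ => g i (t * Complex.I) • (F i).left t)
    (((hg i).continuous_comp (by fun_prop) re_ofReal_mul_I_mem).smul (F i).left.continuous)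
    ((hg i).bounded.choose * ‖(F i).left‖) (fun t => by
      rw [norm_smul]
      have h1 := (hg i).bounded.choose_spec _ (re_ofReal_mul_I_mem t)
      exact mul_le_mul h1 ((F i).left.norm_coe_le_norm t) (norm_nonneg _)
        ((norm_nonneg _).trans h1))
  right := ∑ i ∈ s, BoundedContinuousFunction.ofNormedAddCommGroup
    (fun t : ℝ => g i (1 + t * Complex.I) • (F i).right t)
    (((hg i).continuous_comp (by fun_prop) re_one_add_ofReal_mul_I_mem).smul
      (F i).right.continuous)
    ((hg i).bounded.choose * ‖(F i).right‖) (fun t => by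
      rw [norm_smul]
      have h1 := (hg i).bounded.choose_spec _ (re_one_add_ofReal_mul_I_mem t)
      exact mul_le_mul h1 ((F i).right.norm_coe_le_norm t) (norm_nonneg _)
        ((norm_nonneg _).trans h1))
  continuousOn := continuousOn_finsetSum s fun i _ => (hg i).continuousOn.smul (F i).continuousOn
  bounded := by
    refine ⟨∑ i ∈ s, (hg i).bounded.choose * (F i).bounded.choose, fun z hz => ?_⟩
    refine (norm_sum_le _ _).trans (Finset.sum_le_sum fun i _ => ?_)
    rw [norm_smul]
    have h1 := (hg i).bounded.choose_spec _ hz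
    exact mul_le_mul h1 ((F i).bounded.choose_spec _ hz) (norm_nonneg _) ((norm_nonneg _).trans h1)
  holomorphic := by
    refine DifferentiableOn.fun_sum fun i _ => DifferentiableOn.smul ?_ (F i).holomorphic
    exact fun z hz => ((hg i).differentiableAt z ⟨hz.1.le, hz.2.le⟩).differentiableWithinAt
  left_eq t := by
    simp only [BoundedContinuousFunction.coe_sum, Finset.sum_apply,
      BoundedContinuousFunction.coe_ofNormedAddCommGroup, map_sum, map_smul, (F _).left_eq]
  right_eq t := by
    simp only [BoundedContinuousFunction.coe_sum, Finset.sum_apply,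
      BoundedContinuousFunction.coe_ofNormedAddCommGroup, map_sum, map_smul, (F _).right_eq]

theorem combination_toFun {ι : Type*} (s : Finset ι) (g : ι → ℂ → ℂ)
    (hg : ∀ i, IsStripMultiplier (g i)) (F : ι → CalderonFunction iH iY) (z : ℂ) :
    (combination s g hg F).toFun z = ∑ i ∈ s, g i z • (F i).toFun z := rfl

theorem combination_left {ι : Type*} (s : Finset ι) (g : ι → ℂ → ℂ)
    (hg : ∀ i, IsStripMultiplier (g i)) (F : ι → CalderonFunction iH iY) (t : ℝ) :
    (combination s g hg F).left t = ∑ i ∈ s, g i (t * Complex.I) • (F i).left t := by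
  simp [combination]

theorem combination_right {ι : Type*} (s : Finset ι) (g : ι → ℂ → ℂ)
    (hg : ∀ i, IsStripMultiplier (g i)) (F : ι → CalderonFunction iH iY) (t : ℝ) :
    (combination s g hg F).right t = ∑ i ∈ s, g i (1 + t * Complex.I) • (F i).right t := by
  simp [combination]

/-- A scalar factor equal to `1` at `θ` keeps the value there while redistributing size along the
boundary. Both boundary estimates below consist in choosing `g`. -/
theorem interpNorm_le_of_multiplier (F : CalderonFunction iH iY) {θ : ℝ} {g : ℂ → ℂ}
    (hg : IsStripMultiplier g) (hθ : g θ = 1) {M : ℝ} (hM : 0 ≤ M)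
    (hl : ∀ t : ℝ, ‖g (t * Complex.I)‖ * ‖F.left t‖ ≤ M)
    (hr : ∀ t : ℝ, ‖g (1 + t * Complex.I)‖ * ‖F.right t‖ ≤ M) :
    interpNorm iH iY θ (F.toFun θ) ≤ ENNReal.ofReal M := by
  let G := combination (Finset.univ : Finset Unit) (fun _ => g) (fun _ => hg) (fun _ => F)
  refine (iInf₂_le G (by simp [G, combination_toFun, hθ])).trans (ENNReal.ofReal_le_ofReal ?_)
  refine max_le ?_ ?_
  · refine (BoundedContinuousFunction.norm_le hM).2 fun t => ?_
    simpa [G, combination_left, norm_smul] using hl t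
  · refine (BoundedContinuousFunction.norm_le hM).2 fun t => ?_
    simpa [G, combination_right, norm_smul] using hr t

end CalderonFunction

/-! ### An outer function on a half plane -/

/-- The Cauchy transform of `h`, with the boundary moved to `Re z = -η`. -/
noncomputable def cauchyTransform (h : ℝ → ℝ) (η : ℝ) (z : ℂ) : ℂ :=
  ∫ s : ℝ, (h s : ℂ) / (z + η - s * Complex.I)

namespace cauchyTransform

variable {h : ℝ → ℝ} {η : ℝ}

theorem le_norm_denom (z : ℂ) (s : ℝ) : z.re + η ≤ ‖z + η - s * Complex.I‖ := by
  have := Complex.re_le_norm (z + η - s * Complex.I)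
  simpa using this

theorem denom_ne_zero {z : ℂ} (hz : 0 < z.re + η) (s : ℝ) : z + η - s * Complex.I ≠ 0 :=
  norm_pos_iff.1 (hz.trans_le (le_norm_denom z s))

theorem continuous_integrand (hc : Continuous h) {z : ℂ} (hz : 0 < z.re + η) :
    Continuous fun s : ℝ => (h s : ℂ) / (z + η - s * Complex.I) :=
  Continuous.div (by fun_prop) (by fun_prop) (denom_ne_zero hz)

theorem integrable_integrand (hc : Continuous h) (hs : HasCompactSupport h) {z : ℂ}
    (hz : 0 < z.re + η) : Integrable fun s : ℝ => (h s : ℂ) / (z + η - s * Complex.I) := by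
  refine Integrable.mono' ((hc.integrable_of_hasCompactSupport hs).norm.div_const (z.re + η))
    (continuous_integrand hc hz).aestronglyMeasurable (Eventually.of_forall fun s => ?_)
  rw [norm_div, Complex.norm_real]
  exact div_le_div_of_nonneg_left (norm_nonneg _) hz (le_norm_denom z s)

theorem differentiableAt (hc : Continuous h) (hs : HasCompactSupport h) {z : ℂ}
    (hz : 0 < z.re + η) : DifferentiableAt ℂ (cauchyTransform h η) z := by
  set ε := (z.re + η) / 2 with hε
  have hε0 : 0 < ε := by positivity
  have hball : ∀ w ∈ Metric.ball z ε, ε ≤ w.re + η := by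
    intro w hw
    have h1 := (Complex.abs_re_le_norm (w - z)).trans_lt (mem_ball_iff_norm.1 hw)
    rw [Complex.sub_re] at h1
    have := (abs_lt.1 h1).1
    linarith
  have hcont : Continuous fun s : ℝ => -(h s : ℂ) / (z + η - s * Complex.I) ^ 2 :=
    Continuous.div (by fun_prop) (by fun_prop) fun s => pow_ne_zero 2 (denom_ne_zero hz s)
  refine (hasDerivAt_integral_of_dominated_loc_of_deriv_le (μ := volume)
    (F := fun (w : ℂ) (s : ℝ) => (h s : ℂ) / (w + η - s * Complex.I))
    (F' := fun (w : ℂ) (s : ℝ) => -(h s : ℂ) / (w + η - s * Complex.I) ^ 2)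
    (bound := fun s => ‖h s‖ / ε ^ 2)
    (Metric.ball_mem_nhds z hε0) ?_ (integrable_integrand hc hs hz) hcont.aestronglyMeasurable
    (Eventually.of_forall fun s w hw => ?_)
    ((hc.integrable_of_hasCompactSupport hs).norm.div_const _)
    (Eventually.of_forall fun s w hw => ?_)).2.differentiableAt
  · filter_upwards [Metric.ball_mem_nhds z hε0] with w hw
    exact (continuous_integrand hc (hε0.trans_le (hball w hw))).aestronglyMeasurable
  · rw [norm_div, norm_neg, Complex.norm_real, norm_pow]
    refine div_le_div_of_nonneg_left (norm_nonneg _) (by positivity) ?_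
    exact pow_le_pow_left₀ hε0.le ((hball w hw).trans (le_norm_denom w s)) 2
  · have hne := denom_ne_zero (hε0.trans_le (hball w hw)) s
    have h1 : HasDerivAt (fun w : ℂ => w + η - s * Complex.I) 1 w :=
      ((hasDerivAt_id w).add_const _).sub_const _
    have := (hasDerivAt_const w (h s : ℂ)).fun_div h1 hne
    simpa using this

theorem re_integrand (z : ℂ) (s : ℝ) :
    ((h s : ℂ) / (z + η - s * Complex.I)).re =
      h s * ((z.re + η) / ((z.re + η) ^ 2 + (z.im - s) ^ 2)) := by
  rw [Complex.div_re, Complex.normSq_apply]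
  simp
  ring

theorem re_eq (hc : Continuous h) (hs : HasCompactSupport h) {z : ℂ} (hz : 0 < z.re + η) :
    (cauchyTransform h η z).re =
      ∫ s, h s * ((z.re + η) / ((z.re + η) ^ 2 + (z.im - s) ^ 2)) := by
  have := integral_re (𝕜 := ℂ) (integrable_integrand hc hs hz)
  simp only [RCLike.re_eq_complex_re, re_integrand] at this
  exact this.symm

theorem integrable_re_integrand (hc : Continuous h) (hs : HasCompactSupport h) {z : ℂ}
    (hz : 0 < z.re + η) :
    Integrable fun s => h s * ((z.re + η) / ((z.re + η) ^ 2 + (z.im - s) ^ 2)) := by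
  have := (integrable_integrand hc hs hz).re
  simpa only [RCLike.re_eq_complex_re, re_integrand] using this

theorem re_nonneg (hc : Continuous h) (hs : HasCompactSupport h) (h0 : ∀ s, 0 ≤ h s) {z : ℂ}
    (hz : 0 < z.re + η) : 0 ≤ (cauchyTransform h η z).re := by
  rw [re_eq hc hs hz]
  exact integral_nonneg fun s => mul_nonneg (h0 s) (by positivity)

/-- The real part integrates `h` against a multiple of the Poisson kernel at height `η`. That kernel
is at least `1 / (2 * η)` on `|t - s| ≤ η`, an interval of length `2 * η` on which `h` is at least
`h t - ε`. -/
theorem sub_le_re (hc : Continuous h) (hs : HasCompactSupport h) (h0 : ∀ s, 0 ≤ h s)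
    (hη : 0 < η) {ε : ℝ} (hε : ∀ t s, |t - s| ≤ η → h t - ε ≤ h s) (t : ℝ) :
    h t - ε ≤ (cauchyTransform h η (t * Complex.I)).re := by
  have hz : 0 < ((t : ℂ) * Complex.I).re + η := by simpa using hη
  rcases le_total (h t - ε) 0 with hneg | hpos
  · exact hneg.trans (re_nonneg hc hs h0 hz)
  · rw [re_eq hc hs hz]
    have hI := integrable_re_integrand hc hs hz
    have h1 : ∫ s in Icc (t - η) (t + η), (h t - ε) / (2 * η) = h t - ε := by
      rw [setIntegral_const, Measure.real, Real.volume_Icc, ENNReal.toReal_ofReal (by linarith),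
        smul_eq_mul]
      field_simp
      ring
    rw [← h1]
    refine (setIntegral_mono_on (integrableOn_const (by simp)) hI.integrableOn
      measurableSet_Icc fun s hst => ?_).trans
      (setIntegral_le_integral hI (Eventually.of_forall fun s =>
        mul_nonneg (h0 s) (by positivity)))
    have hts : |t - s| ≤ η := abs_le.2 ⟨by linarith [hst.2], by linarith [hst.1]⟩
    have hsq : (t - s) ^ 2 ≤ η ^ 2 := sq_le_sq' (abs_le.1 hts).1 (abs_le.1 hts).2
    simp only [Complex.mul_re, Complex.ofReal_re, Complex.I_re, mul_zero, Complex.ofReal_im,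
      Complex.I_im, mul_one, sub_self, zero_add, Complex.mul_im, add_zero]
    rw [div_eq_mul_inv]
    refine mul_le_mul (hε t s hts) ?_ (by positivity) (h0 s)
    rw [inv_eq_one_div, div_le_div_iff₀ (by positivity) (by positivity)]
    nlinarith

/-- At an interior point the kernel is comparable to `(1 + s ^ 2)⁻¹`, uniformly in the shift `η ≤
1`. -/
theorem re_ofReal_le (hc : Continuous h) (hs : HasCompactSupport h) (h0 : ∀ s, 0 ≤ h s)
    (hη : 0 < η) (hη1 : η ≤ 1) {θ : ℝ} (hθ : 0 < θ) (hθ1 : θ ≤ 1) :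
    (cauchyTransform h η θ).re ≤ 2 / θ ^ 2 * ∫ s, h s * (1 + s ^ 2)⁻¹ := by
  have hz : 0 < (θ : ℂ).re + η := by simpa using by positivity
  rw [re_eq hc hs hz, ← integral_const_mul]
  have hcont : Continuous fun s : ℝ => h s * (1 + s ^ 2)⁻¹ :=
    hc.mul (Continuous.inv₀ (by fun_prop) fun s => by positivity)
  refine integral_mono (integrable_re_integrand hc hs hz)
    ((hcont.integrable_of_hasCompactSupport hs.mul_right).const_mul _) fun s => ?_
  simp only [Complex.ofReal_re, Complex.ofReal_im, zero_sub, neg_sq]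
  have : (θ + η) / ((θ + η) ^ 2 + s ^ 2) ≤ 2 / θ ^ 2 * (1 + s ^ 2)⁻¹ := by
    rw [← div_eq_mul_inv, div_div, div_le_div_iff₀ (by positivity) (by positivity)]
    have h1 : θ ^ 2 ≤ (θ + η) ^ 2 := by gcongr; linarith
    have h2 : θ ^ 2 ≤ 1 := by nlinarith
    have h3 : θ ^ 2 * s ^ 2 ≤ s ^ 2 := by nlinarith [sq_nonneg s]
    have h4 : θ ^ 2 * (1 + s ^ 2) ≤ (θ + η) ^ 2 + s ^ 2 := by nlinarith
    have h5 : 0 ≤ θ ^ 2 * (1 + s ^ 2) := by positivity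
    nlinarith
  calc h s * _ ≤ h s * (2 / θ ^ 2 * (1 + s ^ 2)⁻¹) := mul_le_mul_of_nonneg_left this (h0 s)
    _ = _ := by ring

end cauchyTransform

/-! ### Interpolation norm from an averaged boundary bound -/

namespace CalderonFunction

variable {H Y V : Type*}
    [NormedAddCommGroup H] [NormedSpace ℂ H] [NormedAddCommGroup Y] [NormedSpace ℂ Y]
    [NormedAddCommGroup V] [NormedSpace ℂ V] {iH : H →L[ℂ] V} {iY : Y →L[ℂ] V}

/-- At `θ = 0` the interpolation norm is controlled by the value at the endpoint. -/
theorem interpNorm_zero_le (F : CalderonFunction iH iY) {a b : ℝ} (ha : 0 < a) (hb : 0 < b)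
    (hr : ∀ t, ‖F.right t‖ ≤ b) (hl : ‖F.left 0‖ ≤ a) :
    interpNorm iH iY 0 (F.toFun (0 : ℝ)) ≤ ENNReal.ofReal (2 * a) := by
  obtain ⟨κ, hκ, hκF⟩ : ∃ κ > 0, ∀ t : ℝ, |t| < κ → ‖F.left t‖ ≤ 2 * a := by
    have h1 : ∀ᶠ t in nhds (0 : ℝ), ‖F.left t‖ < 2 * a :=
      F.left.continuous.norm.continuousAt.eventually_lt continuousAt_const (by linarith)
    obtain ⟨κ, hκ, h⟩ := Metric.eventually_nhds_iff.1 h1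
    exact ⟨κ, hκ, fun t ht => (h (by simpa using ht)).le⟩
  set L := ‖F.left‖
  have hL : 0 ≤ L := norm_nonneg _
  -- The multiplier `δ / (z + δ)` is `1` at the origin and has modulus at most `1` on the strip. The
  -- first bound on `δ` makes it small on the left boundary outside `|t| < κ`, the second makes it
  -- small on the right boundary.
  set δ := min (κ * (2 * a) / (L + 1)) (2 * a / b)
  have hδ : 0 < δ := lt_min (by positivity) (by positivity)
  have hre : ∀ z : ℂ, 0 ≤ z.re → z.re + δ ≤ ‖z + δ‖ := fun z _ => by
    simpa using Complex.re_le_norm (z + δ)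
  have hne : ∀ z : ℂ, 0 ≤ z.re → z + δ ≠ 0 := fun z hz =>
    norm_pos_iff.1 (lt_of_lt_of_le (by linarith) (hre z hz))
  have hng : ∀ z : ℂ, ‖(δ : ℂ) / (z + δ)‖ = δ / ‖z + δ‖ := fun z => by
    rw [norm_div, Complex.norm_real, Real.norm_of_nonneg hδ.le]
  have hg : IsStripMultiplier fun z => (δ : ℂ) / (z + δ) := by
    refine ⟨fun z hz => DifferentiableAt.div (by fun_prop) (by fun_prop) (hne z hz.1), 1,
      fun z hz => ?_⟩
    rw [hng, div_le_one (norm_pos_iff.2 (hne z hz.1))]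
    linarith [hre z hz.1, hz.1]
  refine F.interpNorm_le_of_multiplier hg ?_ (by positivity) (fun t => ?_) fun t => ?_
  · have : (δ : ℂ) ≠ 0 := by exact_mod_cast hδ.ne'
    simp [this]
  · rw [hng]
    have h0 := hre (t * Complex.I) (re_ofReal_mul_I_mem t).1
    simp only [Complex.mul_re, Complex.ofReal_re, Complex.I_re, mul_zero, Complex.ofReal_im,
      Complex.I_im, mul_one, sub_self, zero_add] at h0
    by_cases ht : |t| < κ
    · refine (mul_le_mul ((div_le_one (hδ.trans_le h0)).2 h0) (hκF t ht) (norm_nonneg _)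
        zero_le_one).trans ?_
      rw [one_mul]
    · have h1 : κ ≤ ‖(t : ℂ) * Complex.I + δ‖ := by
        have := Complex.abs_im_le_norm ((t : ℂ) * Complex.I + δ)
        simp at this
        exact (not_lt.1 ht).trans this
      have h2 : δ / ‖(t : ℂ) * Complex.I + δ‖ ≤ δ / κ :=
        div_le_div_of_nonneg_left hδ.le hκ h1
      have h3 : δ / κ ≤ 2 * a / (L + 1) := by
        rw [div_le_iff₀ hκ]
        refine (min_le_left _ _).trans (le_of_eq ?_)
        ring
      calc _ ≤ 2 * a / (L + 1) * (L + 1) :=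
            mul_le_mul (h2.trans h3) ((F.left.norm_coe_le_norm t).trans (by linarith))
              (norm_nonneg _) (by positivity)
        _ = 2 * a := by field_simp
  · rw [hng]
    have h0 := hre (1 + t * Complex.I) (re_one_add_ofReal_mul_I_mem t).1
    simp only [Complex.add_re, Complex.one_re, Complex.mul_re, Complex.ofReal_re, Complex.I_re,
      mul_zero, Complex.ofReal_im, Complex.I_im, mul_one, sub_self, add_zero] at h0
    have h1 : δ / ‖1 + (t : ℂ) * Complex.I + δ‖ ≤ δ :=
      div_le_self hδ.le (by linarith)
    calc _ ≤ 2 * a / b * b :=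
          mul_le_mul (h1.trans (min_le_right _ _)) (hr t) (norm_nonneg _) (by positivity)
      _ = 2 * a := by field_simp

/-- For `0 < θ < 1` a square-mean bound on the left boundary suffices. -/
theorem interpNorm_le_of_integral_le (F : CalderonFunction iH iY) {θ a b : ℝ} (hθ : 0 < θ)
    (hθ1 : θ < 1) (ha : 0 < a) (hb : 0 < b) (hr : ∀ t, ‖F.right t‖ ≤ b)
    (hl : ∫⁻ t : ℝ, ENNReal.ofReal (1 + t ^ 2)⁻¹ * ‖F.left t‖ₑ ^ 2 ≤ ENNReal.ofReal (a ^ 2)) :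
    interpNorm iH iY θ (F.toFun θ) ≤
      ENNReal.ofReal (Real.exp (1 + 2 / θ ^ 2) * (a ^ (1 - θ) * b ^ θ)) := by
  set L := ‖F.left‖
  have hL : 0 ≤ L := norm_nonneg _
  -- The Gaussian makes `h` below compactly supported; the factor `exp (z * z)` in the multiplier,
  -- of modulus `exp (-t ^ 2)` on the left boundary, compensates for it.
  set y : ℝ → ℝ := fun t => ‖F.left t‖ * Real.exp (-t ^ 2) / a with hy
  have hy0 : ∀ t, 0 ≤ y t := fun t => by positivity
  set h : ℝ → ℝ := fun t => Real.log (max 1 (y t)) with hh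
  have hc : Continuous h := by
    refine Continuous.log ?_ fun t => (lt_of_lt_of_le one_pos (le_max_left _ _)).ne'
    exact continuous_const.max (by fun_prop)
  have h0 : ∀ t, 0 ≤ h t := fun t => Real.log_nonneg (le_max_left _ _)
  have hs : HasCompactSupport h := by
    refine HasCompactSupport.intro (isCompact_Icc (a := -(L / a + 1)) (b := L / a + 1))
      fun t ht => ?_
    have h1 : L / a + 1 < |t| := by
      by_contra hcon
      exact ht (abs_le.1 (not_lt.1 hcon))
    have hLa : 0 ≤ L / a := by positivity
    have h2 : L / a ≤ t ^ 2 := by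
      rw [← sq_abs]
      nlinarith
    have h3 : Real.exp (-t ^ 2) ≤ (1 + t ^ 2)⁻¹ := by
      rw [Real.exp_neg]
      refine inv_anti₀ (by positivity) ?_
      linarith [Real.add_one_le_exp (t ^ 2)]
    have h4 : y t ≤ 1 := by
      simp only [hy]
      rw [div_le_one ha]
      calc ‖F.left t‖ * Real.exp (-t ^ 2) ≤ L * (1 + t ^ 2)⁻¹ :=
            mul_le_mul (F.left.norm_coe_le_norm t) h3 (Real.exp_pos _).le hL
        _ ≤ a := by
            rw [← div_eq_mul_inv, div_le_iff₀ (by positivity)]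
            rw [div_le_iff₀ ha] at h2
            nlinarith
    simp [hh, max_eq_left h4]
  have hyh : ∀ t, y t ≤ Real.exp (h t) := fun t => by
    rw [hh, Real.exp_log (lt_of_lt_of_le one_pos (le_max_left _ _))]
    exact le_max_right _ _
  -- The square-mean hypothesis enters only here, through `log y ≤ y ^ 2` for `y ≥ 1`.
  have hint : ∫ s, h s * (1 + s ^ 2)⁻¹ ≤ 1 := by
    have hcont : Continuous fun s : ℝ => h s * (1 + s ^ 2)⁻¹ :=
      hc.mul (Continuous.inv₀ (by fun_prop) fun s => by positivity)
    have hI := hcont.integrable_of_hasCompactSupport (μ := volume) hs.mul_right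
    rw [← ENNReal.ofReal_le_ofReal_iff zero_le_one,
      ofReal_integral_eq_lintegral_ofReal hI (Eventually.of_forall fun s =>
        mul_nonneg (h0 s) (by positivity))]
    have hpt : ∀ s : ℝ, ENNReal.ofReal (h s * (1 + s ^ 2)⁻¹) ≤
        ENNReal.ofReal (a ^ 2)⁻¹ * (ENNReal.ofReal (1 + s ^ 2)⁻¹ * ‖F.left s‖ₑ ^ 2) := by
      intro s
      rw [← ofReal_norm, ← ENNReal.ofReal_pow (norm_nonneg _),
        ← ENNReal.ofReal_mul (by positivity), ← ENNReal.ofReal_mul (by positivity)]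
      refine ENNReal.ofReal_le_ofReal ?_
      have h1 : y s ≤ ‖F.left s‖ / a := by
        simp only [hy]
        gcongr
        exact mul_le_of_le_one_right (norm_nonneg _) (Real.exp_le_one_iff.2 (by nlinarith))
      have h2 : h s ≤ (‖F.left s‖ / a) ^ 2 := by
        refine le_trans ?_ (pow_le_pow_left₀ (hy0 s) h1 2)
        rcases le_total (y s) 1 with h3 | h3
        · simp only [hh, max_eq_left h3, Real.log_one]; positivity
        · simp only [hh, max_eq_right h3]
          nlinarith [Real.log_le_sub_one_of_pos (one_pos.trans_le h3)]
      calc h s * (1 + s ^ 2)⁻¹ ≤ (‖F.left s‖ / a) ^ 2 * (1 + s ^ 2)⁻¹ := by gcongr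
        _ = _ := by rw [div_pow]; ring
    refine (lintegral_mono hpt).trans ?_
    rw [lintegral_const_mul' _ _ ENNReal.ofReal_ne_top]
    refine (mul_le_mul_right hl _).trans ?_
    rw [← ENNReal.ofReal_mul (by positivity), inv_mul_cancel₀ (by positivity)]
  -- Shifting the boundary by `η` makes the Cauchy transform holomorphic up to the strip; uniform
  -- continuity limits the loss to `1`, the summand `1` in the final exponent.
  obtain ⟨η, hη, hη1, hηh⟩ : ∃ η > 0, η ≤ 1 ∧ ∀ t s, |t - s| ≤ η → h t - 1 ≤ h s := by
    obtain ⟨η, hη, H⟩ := Metric.uniformContinuous_iff.1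
      (hs.uniformContinuous_of_continuous hc) 1 one_pos
    refine ⟨min (η / 2) 1, lt_min (by linarith) one_pos, min_le_right _ _, fun t s hts => ?_⟩
    have h1 := H (a := t) (b := s) (by
      rw [Real.dist_eq]
      exact lt_of_le_of_lt (hts.trans (min_le_left _ _)) (by linarith))
    rw [Real.dist_eq] at h1
    linarith [(abs_lt.1 h1).2]
  set Φ := cauchyTransform h η
  have hΦθ : (Φ θ).re ≤ 2 / θ ^ 2 := by
    refine (cauchyTransform.re_ofReal_le hc hs h0 hη hη1 hθ hθ1.le).trans ?_
    exact mul_le_of_le_one_right (by positivity) hint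
  have hpos : ∀ z : ℂ, z.re ∈ Icc (0 : ℝ) 1 → 0 < z.re + η := fun z hz => by linarith [hz.1]
  set l := Real.log a - Real.log b with hldef
  -- Here `φ θ = 0`. The linear term balances the boundaries to give `a ^ (1 - θ) * b ^ θ`; `-Φ`
  -- cancels the peaks of `F.left`, does no harm on the right since `0 ≤ Re Φ`, and costs only `Re Φ
  -- θ ≤ 2 / θ ^ 2`.
  set φ : ℂ → ℂ := fun z => z * z - θ * θ + (z - θ) * l - Φ z + Φ θ with hφ
  have hφre : ∀ z : ℂ, (φ z).re =
      (z.re * z.re - z.im * z.im) - θ * θ + (z.re - θ) * l - (Φ z).re + (Φ θ).re := by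
    intro z
    simp [hφ]
  have hg : IsStripMultiplier fun z => Complex.exp (φ z) := by
    refine IsStripMultiplier.exp (M := 1 + |l| + 2 / θ ^ 2) (fun z hz => ?_) fun z hz => ?_
    · have := cauchyTransform.differentiableAt hc hs (hpos z hz)
      simp only [hφ]
      fun_prop
    · rw [hφre]
      have h1 := cauchyTransform.re_nonneg hc hs h0 (hpos z hz)
      have h2 : (z.re - θ) * l ≤ |l| := by
        refine (le_abs_self _).trans ?_
        rw [abs_mul]
        refine mul_le_of_le_one_left (abs_nonneg _) (abs_le.2 ⟨?_, ?_⟩) <;> linarith [hz.1, hz.2]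
      have h3 : z.re * z.re ≤ 1 := by nlinarith [hz.1, hz.2]
      nlinarith [mul_self_nonneg z.im, mul_self_nonneg θ]
  have hab : a ^ (1 - θ) * b ^ θ = Real.exp (Real.log a - θ * l) := by
    rw [Real.rpow_def_of_pos ha, Real.rpow_def_of_pos hb, ← Real.exp_add]
    congr 1
    rw [hldef]
    ring
  rw [hab, ← Real.exp_add]
  refine F.interpNorm_le_of_multiplier hg ?_ (Real.exp_pos _).le (fun t => ?_) fun t => ?_
  · simp [hφ]
  · rw [Complex.norm_exp, hφre]
    have h1 := cauchyTransform.sub_le_re hc hs h0 hη hηh t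
    have h2 : ‖F.left t‖ ≤ Real.exp (h t + t ^ 2 + Real.log a) := by
      have := hyh t
      simp only [hy] at this
      rw [div_le_iff₀ ha, Real.exp_neg, ← div_eq_mul_inv, div_le_iff₀ (Real.exp_pos _)] at this
      rw [Real.exp_add, Real.exp_add, Real.exp_log ha]
      linarith
    refine (mul_le_mul_of_nonneg_left h2 (Real.exp_pos _).le).trans ?_
    rw [← Real.exp_add]
    refine Real.exp_le_exp.2 ?_
    simp
    nlinarith [mul_self_nonneg θ]
  · rw [Complex.norm_exp, hφre]
    have h1 := cauchyTransform.re_nonneg hc hs h0 (hpos _ (re_one_add_ofReal_mul_I_mem t))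
    have h2 : ‖F.right t‖ ≤ Real.exp (Real.log b) := by
      rw [Real.exp_log hb]
      exact hr t
    refine (mul_le_mul_of_nonneg_left h2 (Real.exp_pos _).le).trans ?_
    rw [← Real.exp_add]
    refine Real.exp_le_exp.2 ?_
    have h3 : Real.log b = Real.log a - l := by rw [hldef]; ring
    rw [h3]
    simp
    nlinarith [mul_self_nonneg θ, mul_self_nonneg t]

end CalderonFunction

/-- There is a finite measure on the left boundary of the strip such that a square-mean bound
with respect to it, and a uniform bound on the right boundary, control the interpolation norm. -/
theorem exists_boundary_measure {H Y V : Type*}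
    [NormedAddCommGroup H] [NormedSpace ℂ H] [NormedAddCommGroup Y] [NormedSpace ℂ Y]
    [NormedAddCommGroup V] [NormedSpace ℂ V] (iH : H →L[ℂ] V) (iY : Y →L[ℂ] V)
    {θ : ℝ} (hθ : 0 ≤ θ) (hθ1 : θ < 1) :
    ∃ ρ : Measure ℝ, IsFiniteMeasure ρ ∧ ∃ C : ℝ, 0 < C ∧
      ∀ (F : CalderonFunction iH iY) (a b : ℝ), 0 < a → 0 < b → (∀ t, ‖F.right t‖ ≤ b) →
        ∫⁻ t, ‖F.left t‖ₑ ^ 2 ∂ρ ≤ ENNReal.ofReal (a ^ 2) →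
        interpNorm iH iY θ (F.toFun θ) ≤ ENNReal.ofReal (C * (a ^ (1 - θ) * b ^ θ)) := by
  rcases hθ.eq_or_lt with rfl | hθ0
  -- The case `θ = 0` is `r = 2`, where the value at the single boundary point `0` is decisive.
  · refine ⟨Measure.dirac 0, inferInstance, 2, two_pos, fun F a b ha hb hr hl => ?_⟩
    rw [lintegral_dirac, ← ofReal_norm, ← ENNReal.ofReal_pow (norm_nonneg _),
      ENNReal.ofReal_le_ofReal_iff (by positivity), sq_le_sq₀ (norm_nonneg _) ha.le] at hl
    simpa using F.interpNorm_zero_le ha hb hr hl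
  · have hm : Measurable fun t : ℝ => ENNReal.ofReal (1 + t ^ 2)⁻¹ := by fun_prop
    refine ⟨volume.withDensity fun t => ENNReal.ofReal (1 + t ^ 2)⁻¹,
      isFiniteMeasure_withDensity_ofReal integrable_inv_one_add_sq.2,
      Real.exp (1 + 2 / θ ^ 2), Real.exp_pos _, fun F a b ha hb hr hl => ?_⟩
    refine F.interpNorm_le_of_integral_le hθ0 hθ1 ha hb hr ?_
    rwa [lintegral_withDensity_eq_lintegral_mul _ hm (by
      have := F.left.continuous
      exact (by fun_prop : Continuous fun t => ‖F.left t‖ₑ ^ 2).measurable)] at hl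

/-! ### The weak tile-type inequality for `r`-Hilbertian spaces -/

theorem memLp_wavePacket (P : Tile) (p : ℝ≥0∞) : MemLp P.wavePacket p volume := by
  rcases eq_or_ne p 0 with rfl | hp
  · exact memLp_zero_iff_aestronglyMeasurable.2 P.measurable_wavePacket.aestronglyMeasurable
  have h : MemLp (P.time.toSet.indicator fun _ => ((P.time.length : ℝ))⁻¹) p volume :=
    memLp_indicator_const p P.time.measurableSet_toSet _ (Or.inr P.time.volume_toSet_ne_top)
  refine h.mono P.measurable_wavePacket.aestronglyMeasurable (Eventually.of_forall fun x => ?_)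
  rw [P.norm_wavePacket]
  exact le_abs_self _

/-- The scalar coefficients do not depend on `φ` or `Z`. The same combination therefore computes the
pairings in `X`, in `H` and in `Y`. -/
theorem integral_smul_comp_simpleFunc {α X Z : Type*} [MeasurableSpace α] {μ : Measure α}
    [Zero X] [DecidableEq X] [NormedAddCommGroup Z] [NormedSpace ℂ Z] [CompleteSpace Z]
    (f : SimpleFunc α X)
    {w : α → ℂ} (hw : Integrable w μ) (φ : X → Z) (hφ : φ 0 = 0) :
    ∫ x, w x • φ (f x) ∂μ =
      ∑ v ∈ f.range.filter (· ≠ 0), (∫ x in f ⁻¹' {v}, w x ∂μ) • φ v := by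
  have hpt : ∀ x, w x • φ (f x) =
      ∑ v ∈ f.range.filter (· ≠ 0), (f ⁻¹' {v}).indicator w x • φ v := by
    intro x
    by_cases hx : f x = 0
    · rw [hx, hφ, smul_zero, Finset.sum_eq_zero]
      intro v hv
      rw [indicator_of_notMem, zero_smul]
      simp only [mem_preimage, hx, mem_singleton_iff]
      exact fun h => (Finset.mem_filter.1 hv).2 h.symm
    · rw [Finset.sum_eq_single (f x)]
      · simp
      · intro v _ hv
        rw [indicator_of_notMem, zero_smul]
        simp only [mem_preimage, mem_singleton_iff]
        exact fun h => hv h.symm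
      · intro h
        exact absurd (Finset.mem_filter.2 ⟨f.mem_range_self x, hx⟩) h
  simp only [hpt]
  rw [integral_finsetSum]
  · refine Finset.sum_congr rfl fun v _ => ?_
    rw [integral_smul_const, integral_indicator (f.measurableSet_preimage _)]
  · exact fun v _ => (hw.indicator (f.measurableSet_preimage _)).smul_const _

/-- The Bessel inequality for wave packets of disjoint tiles. -/
theorem tile_bessel_inequality {H : Type*} [NormedAddCommGroup H] [InnerProductSpace ℂ H]
    [CompleteSpace H] (s : Finset Tile)
    (hs : ∀ P ∈ s, ∀ Q ∈ s, P ≠ Q → Disjoint P.toSet Q.toSet)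
    (f : Walsh → H) (hf : MemLp f 2 volume) :
    ∑ P ∈ s, (P.time.length : ℝ≥0∞) * ‖∫ x, P.wavePacket x • f x‖ₑ ^ 2 ≤ ∫⁻ x, ‖f x‖ₑ ^ 2 := by
  have h := vector_bessel_inequality (μ := volume) s (fun P => P.wavePacket)
    (fun P => (P.time.length : ℝ)) (fun P _ => by exact_mod_cast P.time.length_pos)
    (fun P _ => memLp_wavePacket P 2) (fun P _ => P.integral_wavePacket_mul_conj_self)
    (fun P hP Q hQ hPQ => Tile.integral_wavePacket_mul_conj (hs P hP Q hQ hPQ)) f hf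
  have h2 := ENNReal.ofReal_le_ofReal h
  rw [ENNReal.ofReal_sum_of_nonneg fun P _ => by positivity,
    ofReal_integral_eq_lintegral_ofReal (hf.integrable_norm_pow two_ne_zero)
      (Eventually.of_forall fun x => by positivity)] at h2
  simpa only [ENNReal.ofReal_mul (NNReal.coe_nonneg _), ENNReal.ofReal_coe_nnreal,
    ENNReal.ofReal_pow (norm_nonneg _), ofReal_norm] using h2

theorem norm_integral_wavePacket_smul_le {Z : Type*} [NormedAddCommGroup Z] [NormedSpace ℂ Z]
    (P : Tile) (f : Walsh → Z) {b : ℝ} (hf : ∀ x, ‖f x‖ ≤ b) :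
    ‖∫ x, P.wavePacket x • f x‖ ≤ b := by
  refine (norm_integral_le_of_norm_le (P.integrable_wavePacket.norm.mul_const b)
    (Eventually.of_forall fun x => ?_)).trans_eq ?_
  · rw [norm_smul]
    exact mul_le_mul_of_nonneg_left (hf x) (norm_nonneg _)
  · rw [integral_mul_const, P.integral_norm_wavePacket, one_mul]

/-- The multiplier `‖v‖ ^ (r (1 - z) / 2 - 1)`. -/
noncomputable def normPower (r m : ℝ) (z : ℂ) : ℂ :=
  Complex.exp (((r / 2 : ℝ) * (1 - z) - 1) * (Real.log m : ℝ))

theorem isStripMultiplier_normPower {r : ℝ} (hr : 0 ≤ r) (m : ℝ) :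
    IsStripMultiplier (normPower r m) := by
  refine IsStripMultiplier.exp (M := (r / 2 + 1) * |Real.log m|) (fun z _ => by fun_prop)
    fun z hz => ?_
  have h1 : ((((r / 2 : ℝ) : ℂ) * (1 - z) - 1) * ((Real.log m : ℝ) : ℂ)).re =
      ((r / 2) * (1 - z.re) - 1) * Real.log m := by
    simp
  rw [h1]
  refine (le_abs_self _).trans ?_
  rw [abs_mul]
  refine mul_le_mul_of_nonneg_right (abs_le.2 ⟨?_, ?_⟩) (abs_nonneg _) <;>
    nlinarith [hz.1, hz.2]

theorem normPower_eq_one {r θ : ℝ} (h : r / 2 * (1 - θ) = 1) (m : ℝ) : normPower r m θ = 1 := by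
  have : (((r / 2 : ℝ) : ℂ) * (1 - (θ : ℂ)) - 1) = 0 := by
    rw [sub_eq_zero]
    exact_mod_cast h
  rw [normPower, this, zero_mul, Complex.exp_zero]

theorem norm_normPower_left {r m : ℝ} (hm : 0 < m) (t : ℝ) :
    ‖normPower r m (t * Complex.I)‖ * m = m ^ (r / 2) := by
  rw [normPower, Complex.norm_exp, Real.rpow_def_of_pos hm]
  conv_lhs => rw [← Real.exp_log hm]
  rw [Real.log_exp, ← Real.exp_add]
  congr 1
  simp
  ring

theorem norm_normPower_right {r m : ℝ} (hm : 0 < m) (t : ℝ) :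
    ‖normPower r m (1 + t * Complex.I)‖ * m = 1 := by
  rw [normPower, Complex.norm_exp]
  conv_lhs => rw [← Real.exp_log hm]
  rw [Real.log_exp, ← Real.exp_add, ← Real.exp_zero]
  congr 1
  simp

theorem IsRHilbertian.exists_tile_bound {X : Type u} [NormedAddCommGroup X] [NormedSpace ℂ X]
    [CompleteSpace X] {r : ℝ} (hr : 2 ≤ r) (hX : IsRHilbertian.{u, v} r X) :
    ∃ C : ℝ≥0, ∀ (s : Finset Tile),
      (∀ P ∈ s, ∀ Q ∈ s, P ≠ Q → Disjoint P.toSet Q.toSet) →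
      ∀ f : SimpleFunc Walsh X, Integrable f volume → ∀ τ : ℝ, 0 < τ →
      (∀ P ∈ s, τ ≤ ‖walshPairing f P.wavePacket‖) →
      (∑ P ∈ s, (P.time.length : ℝ≥0∞)) * ENNReal.ofReal (τ ^ r) ≤
        C * ∫⁻ x, ‖f x‖ₑ ^ r := by
  classical
  obtain ⟨H, _, _, _, Y, _, _, _, V, _, _, _, iH, iY, θ, J, K, -, -, -, hθ, hrθ, -, hJ⟩ := hX
  have hr0 : 0 < r := by linarith
  have hθr : r / 2 * (1 - θ) = 1 := by
    have : (1 - θ) = 2 / r := by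
      rw [show 2 / r = 2 * (1 / r) by ring, hrθ]; ring
    rw [this]; field_simp
  have hθ1 : θ < 1 := by
    by_contra hcon
    have : 1 - θ ≤ 0 := by linarith
    nlinarith
  obtain ⟨ρ, hρ, C, hC, hF⟩ := exists_boundary_measure iH iY hθ.1 hθ1
  -- Strictly above `K`, so that the infimum defining `interpNorm` is beaten by an actual Calderón
  -- function for every nonzero `x`.
  set k : ℝ := K + 1 with hk
  have hk0 : 0 < k := by positivity
  have hcald : ∀ x : X, ∃ F : CalderonFunction iH iY, F.toFun θ = J x ∧
      (x ≠ 0 → ‖F.left‖ ≤ k * ‖x‖ ∧ ‖F.right‖ ≤ k * ‖x‖) := by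
    intro x
    by_cases hx : x = 0
    · have h1 : interpNorm iH iY θ (J x) < ∞ :=
        (hJ x).1.trans_lt (ENNReal.mul_lt_top ENNReal.coe_lt_top enorm_lt_top)
      simp only [interpNorm, iInf_lt_iff] at h1
      obtain ⟨F, hFx, -⟩ := h1
      exact ⟨F, hFx, fun h => absurd hx h⟩
    · have hx0 : 0 < ‖x‖ := norm_pos_iff.2 hx
      have h1 : interpNorm iH iY θ (J x) < ENNReal.ofReal (k * ‖x‖) := by
        refine (hJ x).1.trans_lt ?_
        rw [← ofReal_norm, ← ENNReal.ofReal_coe_nnreal, ← ENNReal.ofReal_mul (by positivity)]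
        refine (ENNReal.ofReal_lt_ofReal_iff (by positivity)).2 ?_
        rw [hk]
        nlinarith
      simp only [interpNorm, iInf_lt_iff] at h1
      obtain ⟨F, hFx, h2⟩ := h1
      have h3 := ((ENNReal.ofReal_lt_ofReal_iff (by positivity)).1 h2).le
      exact ⟨F, hFx, fun _ => ⟨(le_max_left _ _).trans h3, (le_max_right _ _).trans h3⟩⟩
  choose F hFθ hFn using hcald
  -- Chosen so that a square mean below `(d * τ) ^ r` would bound the coefficient by `τ / 2`,
  -- contradicting the lower bound `τ`.
  set d : ℝ := 1 / (2 * k * C * k ^ θ) with hd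
  have hd0 : 0 < d := by positivity
  refine ⟨(ENNReal.ofReal (d ^ r)⁻¹ * (ENNReal.ofReal (k ^ 2) * ρ univ)).toNNReal,
    fun s hs f hf τ hτ hτs => ?_⟩
  rw [ENNReal.coe_toNNReal (ENNReal.mul_ne_top ENNReal.ofReal_ne_top
    (ENNReal.mul_ne_top ENNReal.ofReal_ne_top (measure_ne_top _ _)))]
  set I := f.range.filter (· ≠ 0)
  set A : Tile → X → ℂ := fun P v => ∫ x in f ⁻¹' {v}, P.wavePacket x
  set G : Tile → CalderonFunction iH iY := fun P =>
    CalderonFunction.combination I (fun v z => A P v * normPower r ‖v‖ z)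
      (fun v => (isStripMultiplier_normPower hr0.le _).const_mul _) F
  have hGθ : ∀ P, (G P).toFun θ = J (walshPairing f P.wavePacket) := by
    intro P
    rw [walshPairing, integral_smul_comp_simpleFunc f P.integrable_wavePacket (fun v => v) rfl,
      CalderonFunction.combination_toFun, map_sum]
    refine Finset.sum_congr rfl fun v _ => ?_
    rw [normPower_eq_one hθr, mul_one, hFθ, map_smul]
  -- The boundary values of the extension of `f` are `φ t ∘ f` and `ψ t ∘ f`. At `v = 0` they are
  -- set to zero because no bound was imposed on `F 0`.
  set φ : ℝ → X → H := fun t v =>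
    if v = 0 then 0 else normPower r ‖v‖ (t * Complex.I) • (F v).left t
  set ψ : ℝ → X → Y := fun t v =>
    if v = 0 then 0 else normPower r ‖v‖ (1 + t * Complex.I) • (F v).right t
  have hφ : ∀ t v, ‖φ t v‖ ≤ k * ‖v‖ ^ (r / 2) := by
    intro t v
    by_cases hv : v = 0
    · simp only [φ, if_pos hv, norm_zero]; positivity
    · simp only [φ, if_neg hv]
      rw [norm_smul, ← norm_normPower_left (norm_pos_iff.2 hv) t]
      calc _ ≤ ‖normPower r ‖v‖ (t * Complex.I)‖ * (k * ‖v‖) :=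
            mul_le_mul_of_nonneg_left (((F v).left.norm_coe_le_norm t).trans (hFn v hv).1)
              (norm_nonneg _)
        _ = _ := by ring
  have hψ : ∀ t v, ‖ψ t v‖ ≤ k := by
    intro t v
    by_cases hv : v = 0
    · simp only [ψ, if_pos hv, norm_zero]; positivity
    · simp only [ψ, if_neg hv]
      rw [norm_smul]
      calc _ ≤ ‖normPower r ‖v‖ (1 + t * Complex.I)‖ * (k * ‖v‖) :=
            mul_le_mul_of_nonneg_left (((F v).right.norm_coe_le_norm t).trans (hFn v hv).2)
              (norm_nonneg _)
        _ = k * (‖normPower r ‖v‖ (1 + t * Complex.I)‖ * ‖v‖) := by ring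
        _ = k := by rw [norm_normPower_right (norm_pos_iff.2 hv), mul_one]
  have hGl : ∀ P t, (G P).left t = ∫ x, P.wavePacket x • φ t (f x) := by
    intro P t
    rw [integral_smul_comp_simpleFunc f P.integrable_wavePacket (φ t) (if_pos rfl),
      CalderonFunction.combination_left]
    refine Finset.sum_congr rfl fun v hv => ?_
    simp only [φ, if_neg (Finset.mem_filter.1 hv).2, smul_smul, A]
  have hGr : ∀ P t, (G P).right t = ∫ x, P.wavePacket x • ψ t (f x) := by
    intro P t
    rw [integral_smul_comp_simpleFunc f P.integrable_wavePacket (ψ t) (if_pos rfl),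
      CalderonFunction.combination_right]
    refine Finset.sum_congr rfl fun v hv => ?_
    simp only [ψ, if_neg (Finset.mem_filter.1 hv).2, smul_smul, A]
  have hGrb : ∀ P t, ‖(G P).right t‖ ≤ k := fun P t => by
    rw [hGr]
    exact norm_integral_wavePacket_smul_le P _ fun x => hψ t _
  set N := ∫⁻ x, ‖f x‖ₑ ^ r
  have hsum : ∀ t, ∑ P ∈ s, (P.time.length : ℝ≥0∞) * ‖(G P).left t‖ₑ ^ 2 ≤
      ENNReal.ofReal (k ^ 2) * N := by
    intro t
    have hmem : MemLp (fun x => φ t (f x)) 2 volume := by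
      have : MemLp (f.map (φ t)) 2 volume := by
        refine SimpleFunc.memLp_of_finite_measure_preimage 2 fun y hy => ?_
        have hfin := (SimpleFunc.integrable_iff_finMeasSupp.1 hf).map (g := φ t) (if_pos rfl)
        exact (SimpleFunc.finMeasSupp_iff.1 hfin) y hy
      exact this
    simp only [hGl]
    refine (tile_bessel_inequality s hs _ hmem).trans ?_
    rw [← lintegral_const_mul' _ _ ENNReal.ofReal_ne_top]
    refine lintegral_mono fun x => ?_
    have h1 := pow_le_pow_left₀ (norm_nonneg _) (hφ t (f x)) 2
    have h2 := ENNReal.ofReal_le_ofReal h1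
    rw [ENNReal.ofReal_pow (norm_nonneg _), ofReal_norm, mul_pow, ← Real.rpow_mul_natCast
      (norm_nonneg _), ENNReal.ofReal_mul (by positivity)] at h2
    rwa [show r / 2 * ((2 : ℕ) : ℝ) = r by push_cast; ring,
      ← ENNReal.ofReal_rpow_of_nonneg (norm_nonneg _) hr0.le, ofReal_norm] at h2
  have hlow : ∀ P ∈ s, ENNReal.ofReal ((d * τ) ^ r) ≤ ∫⁻ t, ‖(G P).left t‖ₑ ^ 2 ∂ρ := by
    intro P hP
    by_contra! hcon
    have hdτ : 0 < d * τ := by positivity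
    -- The exponent `r / 2` is inverse to `1 - θ`, so `a ^ (1 - θ) = d * τ`.
    have h1 := hF (G P) ((d * τ) ^ (r / 2)) k (by positivity) hk0 (hGrb P) (by
      refine hcon.le.trans_eq ?_
      rw [← Real.rpow_mul_natCast hdτ.le]
      congr 2
      push_cast
      ring)
    rw [← Real.rpow_mul hdτ.le, hθr, Real.rpow_one, hGθ] at h1
    have h2 : ENNReal.ofReal τ ≤ ENNReal.ofReal (k * (C * (d * τ * k ^ θ))) := by
      refine (ENNReal.ofReal_le_ofReal (hτs P hP)).trans ?_
      rw [ofReal_norm, ENNReal.ofReal_mul hk0.le]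
      refine (hJ _).2.trans (mul_le_mul' ?_ h1)
      rw [← ENNReal.ofReal_coe_nnreal]
      exact ENNReal.ofReal_le_ofReal (by rw [hk]; linarith)
    rw [ENNReal.ofReal_le_ofReal_iff (by positivity)] at h2
    have h3 : k * (C * (d * τ * k ^ θ)) = τ / 2 := by
      rw [hd]
      field_simp
    linarith
  have hmain : (∑ P ∈ s, (P.time.length : ℝ≥0∞)) * ENNReal.ofReal ((d * τ) ^ r) ≤
      ENNReal.ofReal (k ^ 2) * N * ρ univ := by
    rw [Finset.sum_mul]
    calc _ ≤ ∑ P ∈ s, (P.time.length : ℝ≥0∞) * ∫⁻ t, ‖(G P).left t‖ₑ ^ 2 ∂ρ :=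
          Finset.sum_le_sum fun P hP => mul_le_mul_right (hlow P hP) _
      _ = ∫⁻ t, ∑ P ∈ s, (P.time.length : ℝ≥0∞) * ‖(G P).left t‖ₑ ^ 2 ∂ρ := by
          have hcont : ∀ P, Continuous fun t => ‖(G P).left t‖ₑ ^ 2 := fun P => by
            have := (G P).left.continuous
            fun_prop
          rw [lintegral_finsetSum _ fun P _ => (hcont P).measurable.const_mul _]
          exact Finset.sum_congr rfl fun P _ =>
            (lintegral_const_mul _ (hcont P).measurable).symm
      _ ≤ ∫⁻ _, ENNReal.ofReal (k ^ 2) * N ∂ρ := lintegral_mono hsum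
      _ = _ := lintegral_const _
  rw [Real.mul_rpow hd0.le hτ.le, ENNReal.ofReal_mul (by positivity)] at hmain
  have hdr : ENNReal.ofReal (d ^ r)⁻¹ * ENNReal.ofReal (d ^ r) = 1 := by
    rw [← ENNReal.ofReal_mul (by positivity), inv_mul_cancel₀ (by positivity), ENNReal.ofReal_one]
  calc (∑ P ∈ s, (P.time.length : ℝ≥0∞)) * ENNReal.ofReal (τ ^ r)
      = ENNReal.ofReal (d ^ r)⁻¹ * ((∑ P ∈ s, (P.time.length : ℝ≥0∞)) *
          (ENNReal.ofReal (d ^ r) * ENNReal.ofReal (τ ^ r))) := by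
        rw [← one_mul ((∑ P ∈ s, (P.time.length : ℝ≥0∞)) * ENNReal.ofReal (τ ^ r)), ← hdr]
        ring
    _ ≤ ENNReal.ofReal (d ^ r)⁻¹ * (ENNReal.ofReal (k ^ 2) * N * ρ univ) :=
        mul_le_mul_right hmain _
    _ = _ := by ring

/-! ### Schwartz functions as simple functions -/

namespace Walsh

theorem isCompact_ball_pow (n : ℕ) : IsCompact (Metric.ball (0 : Walsh) ((3 : ℝ) ^ n)) := by
  induction n with
  | zero => simpa using isCompact_unitBall
  | succ n ih =>
    have h : Metric.ball (0 : Walsh) ((3 : ℝ) ^ (n + 1)) =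
        ⋃ d : ZMod 3, (fun x => single n d + x) '' Metric.ball (0 : Walsh) ((3 : ℝ) ^ n) := by
      ext x
      have h1 := mem_ball_iff 0 x (n + 1)
      rw [show ((3 : ℝ) ^ ((n : ℤ) + 1)) = 3 ^ (n + 1) by norm_cast] at h1
      have h2 : ∀ y, y ∈ Metric.ball (0 : Walsh) ((3 : ℝ) ^ n) ↔
          ∀ j, (n : ℤ) ≤ j → y.digit j = 0 := fun y => by
        have := mem_ball_iff 0 y n
        rwa [zpow_natCast] at this
      rw [h1]
      simp only [mem_iUnion, mem_image, h2]
      constructor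
      · intro hx
        refine ⟨x.digit n, x - single n (x.digit n), fun j hj => ?_, by abel⟩
        rw [digit_sub, digit_single]
        split_ifs with hjn
        · rw [hjn, sub_self]
        · rw [hx j (by omega), digit_zero, sub_zero]
      · rintro ⟨d, y, hy, rfl⟩ j hj
        rw [digit_add, hy j (by omega), digit_single, if_neg (by omega), add_zero, digit_zero]
    rw [h]
    exact isCompact_iUnion fun d => ih.image (continuous_const.add continuous_id)

/-- This makes Haar measure σ-finite, as Tonelli's theorem requires in `lintegral_maximal_le`. -/
instance : SigmaCompactSpace Walsh := by
  refine SigmaCompactSpace_iff_exists_compact_covering.2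
    ⟨fun n => Metric.ball 0 ((3 : ℝ) ^ n), isCompact_ball_pow, ?_⟩
  refine eq_univ_of_forall fun x => mem_iUnion.2 ?_
  obtain ⟨n, hn⟩ := pow_unbounded_of_one_lt ‖x‖ (by norm_num : (1 : ℝ) < 3)
  exact ⟨n, by simpa using hn⟩

end Walsh

theorem IsWalshSchwartz.isLocallyConstant {X : Type*} [Zero X] {f : Walsh → X}
    (hf : IsWalshSchwartz f) : IsLocallyConstant f := by
  obtain ⟨N, -, -, hN⟩ := hf
  rw [IsLocallyConstant.iff_exists_open]
  intro x
  obtain ⟨I, hI, hx⟩ := WInterval.exists_mem_toSet x (-(N : ℤ) - 1)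
  refine ⟨I.toSet, Metric.isOpen_ball, hx, fun y hy => hN I ?_ y hy x hx⟩
  rw [WInterval.length, hI]
  exact zpow_lt_zpow_right₀ (by norm_num) (by omega)

/-- A locally constant function takes finitely many values on the compact ball that contains its
support. -/
theorem IsWalshSchwartz.exists_simpleFunc {X : Type*} [NormedAddCommGroup X] {f : Walsh → X}
    (hf : IsWalshSchwartz f) :
    ∃ g : SimpleFunc Walsh X, (g : Walsh → X) = f ∧ Integrable g volume := by
  have hloc := hf.isLocallyConstant
  obtain ⟨N, -, hN, -⟩ := hf
  have hK := Walsh.isCompact_ball_pow N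
  set K := Metric.ball (0 : Walsh) ((3 : ℝ) ^ N)
  have hfin : (range f).Finite := by
    have : CompactSpace K := isCompact_iff_compactSpace.1 hK
    have h1 := (hloc.comp_continuous (continuous_subtype_val (p := (· ∈ K)))).range_finite
    refine (h1.insert 0).subset ?_
    rintro _ ⟨x, rfl⟩
    by_cases hx : x ∈ K
    · exact Or.inr ⟨⟨x, hx⟩, rfl⟩
    · exact Or.inl (hN x hx)
  refine ⟨⟨f, fun y => (hloc {y}).measurableSet, hfin⟩, rfl, ?_⟩
  rw [SimpleFunc.integrable_iff]
  intro y hy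
  refine (measure_mono (t := K) fun x hx => ?_).trans_lt hK.measure_lt_top
  by_contra hxK
  have h1 : f x = y := hx
  exact hy (h1.symm.trans (hN x hxK))

/-! ### Outer measures and covers by maximal elements -/

namespace OuterData

variable {α V : Type*} (O : OuterData α V)

theorem outerMeasure_le_tsum {A : Set α} (E : Set O.Index) (hE : E.Countable)
    (h : A ⊆ ⋃ i ∈ E, O.gen i) : O.outerMeasure A ≤ ∑' i : E, (O.premeasure i : ℝ≥0∞) :=
  iInf_le_of_le E (iInf_le_of_le hE (iInf_le _ h))

theorem outerMeasure_mono {A B : Set α} (h : A ⊆ B) : O.outerMeasure A ≤ O.outerMeasure B :=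
  le_iInf fun E => le_iInf fun hE => le_iInf fun hB => O.outerMeasure_le_tsum E hE (h.trans hB)

theorem outerMeasure_empty : O.outerMeasure ∅ = 0 := by
  have := O.outerMeasure_le_tsum (A := ∅) ∅ countable_empty (empty_subset _)
  simpa using this

theorem superlevel_le [Zero V] {F : α → V} {t : ℝ} (A : Set α)
    (h : O.supSize (Aᶜ.indicator F) ≤ ENNReal.ofReal t) : O.superlevel F t ≤ O.outerMeasure A :=
  iInf₂_le A h

end OuterData

/-- A family of intervals of bounded scale is covered by its maximal members, which are pairwise
disjoint. -/
theorem exists_maximal_intervals (B : Set WInterval) {n : ℤ} (hB : ∀ J ∈ B, J.scale ≤ n) :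
    ∃ M ⊆ B, (∀ J ∈ M, ∀ J' ∈ M, J ≠ J' → Disjoint J.toSet J'.toSet) ∧
      ∀ J ∈ B, ∃ J' ∈ M, J.toSet ⊆ J'.toSet := by
  refine ⟨{J ∈ B | ∀ J' ∈ B, J.toSet ⊆ J'.toSet → J'.scale ≤ J.scale}, fun J hJ => hJ.1, ?_, ?_⟩
  · have key : ∀ J J' : WInterval, J.scale ≤ J'.scale → J' ∈ B →
        (∀ J' ∈ B, J.toSet ⊆ J'.toSet → J'.scale ≤ J.scale) → J ≠ J' →
        Disjoint J.toSet J'.toSet := by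
      intro J J' hs hJ' hmax hne
      by_contra hd
      obtain ⟨x, hx, hx'⟩ := Set.not_disjoint_iff.1 hd
      exact hne (WInterval.ext_of_mem
        (le_antisymm hs (hmax J' hJ' (WInterval.subset_of_mem hs hx hx'))) hx hx')
    intro J hJ J' hJ' hne
    rcases le_total J.scale J'.scale with hs | hs
    · exact key J J' hs hJ'.1 hJ.2 hne
    · exact (key J' J hs hJ.1 hJ'.2 hne.symm).symm
  · intro J hJ
    obtain ⟨m, ⟨J', hJ', hsub, rfl⟩, hmax⟩ := Int.exists_greatest_of_bdd
      (P := fun m => ∃ J' ∈ B, J.toSet ⊆ J'.toSet ∧ J'.scale = m)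
      ⟨n, by rintro _ ⟨J', hJ', -, rfl⟩; exact hB J' hJ'⟩ ⟨J.scale, J, hJ, subset_rfl, rfl⟩
    exact ⟨J', ⟨hJ', fun J'' hJ'' h => hmax _ ⟨J'', hJ'', hsub.trans h, rfl⟩⟩, hsub⟩

/-- A family of tritiles of bounded scale is covered by the trees of its maximal members, which
are pairwise disjoint. -/
theorem exists_maximal_tritiles (E : Set Tritile) {n : ℤ} (hE : ∀ P ∈ E, P.time.scale ≤ n) :
    ∃ M ⊆ E, (∀ P ∈ M, ∀ Q ∈ M, P ≠ Q →
        Disjoint (P.time.toSet ×ˢ P.freq.toSet) (Q.time.toSet ×ˢ Q.freq.toSet)) ∧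
      E ⊆ ⋃ P ∈ M, P.tree := by
  refine ⟨{P ∈ E | ∀ Q ∈ E, P.below Q → Q.time.scale ≤ P.time.scale}, fun P hP => hP.1, ?_, ?_⟩
  · have key : ∀ P Q : Tritile, P.time.scale ≤ Q.time.scale → Q ∈ E →
        (∀ Q ∈ E, P.below Q → Q.time.scale ≤ P.time.scale) → P ≠ Q →
        Disjoint (P.time.toSet ×ˢ P.freq.toSet) (Q.time.toSet ×ˢ Q.freq.toSet) := by
      intro P Q hs hQ hmax hne
      by_contra hd
      exact hne (Tritile.eq_of_not_disjoint hd
        (le_antisymm hs (hmax Q hQ (Tritile.below_of_not_disjoint hd hs))))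
    intro P hP Q hQ hne
    rcases le_total P.time.scale Q.time.scale with hs | hs
    · exact key P Q hs hQ.1 hP.2 hne
    · exact (key Q P hs hP.1 hQ.2 hne.symm).symm
  · intro P hP
    obtain ⟨m, ⟨Q, hQ, hb, rfl⟩, hmax⟩ := Int.exists_greatest_of_bdd
      (P := fun m => ∃ Q ∈ E, P.below Q ∧ Q.time.scale = m)
      ⟨n, by rintro _ ⟨Q, hQ, -, rfl⟩; exact hE Q hQ⟩
      ⟨P.time.scale, P, hP, P.below_refl, rfl⟩
    refine mem_iUnion₂.2 ⟨Q, ⟨hQ, fun R hR h => ?_⟩, hb⟩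
    exact hmax _ ⟨R, hR, Tritile.below_trans hb h, rfl⟩

/-- The trees of the maximal tritiles cover `E`. In each maximal tritile pick a subtile with a large
coefficient; these are disjoint, so the tile inequality `hC` bounds the cost of the cover. The scale
bound guarantees that maximal members exist. -/
theorem treeSInfty_outerMeasure_mul_le {X : Type*} [NormedAddCommGroup X] [NormedSpace ℂ X]
    {r : ℝ} {C : ℝ≥0}
    (hC : ∀ (s : Finset Tile),
      (∀ P ∈ s, ∀ Q ∈ s, P ≠ Q → Disjoint P.toSet Q.toSet) →
      ∀ f : SimpleFunc Walsh X, Integrable f volume → ∀ τ : ℝ, 0 < τ →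
      (∀ P ∈ s, τ ≤ ‖walshPairing f P.wavePacket‖) →
      (∑ P ∈ s, (P.time.length : ℝ≥0∞)) * ENNReal.ofReal (τ ^ r) ≤ C * ∫⁻ x, ‖f x‖ₑ ^ r)
    (f : SimpleFunc Walsh X) (hf : Integrable f volume) {τ : ℝ} (hτ : 0 < τ) (E : Set Tritile)
    {n : ℤ} (hE : ∀ P ∈ E, P.time.scale ≤ n)
    (hEτ : ∀ P ∈ E, ∃ u, τ ≤ ‖walshPairing f (P.tile u).wavePacket‖) :
    treeSInfty.outerMeasure E * ENNReal.ofReal (τ ^ r) ≤ C * ∫⁻ x, ‖f x‖ₑ ^ r := by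
  classical
  obtain ⟨M, hME, hdisj, hcov⟩ := exists_maximal_tritiles E hE
  have h1 := treeSInfty.outerMeasure_le_tsum M M.to_countable hcov
  refine (mul_le_mul_left h1 _).trans ?_
  change (∑' P : M, ((P : Tritile).time.length : ℝ≥0∞)) * _ ≤ _
  rw [ENNReal.tsum_eq_iSup_sum, ENNReal.iSup_mul]
  refine iSup_le fun s => ?_
  choose! w hw using hEτ
  set T : M → Tile := fun P => (P : Tritile).tile (w P)
  have hTd : ∀ P Q : M, P ≠ Q → Disjoint (T P).toSet (T Q).toSet := fun P Q h =>
    (hdisj P P.2 Q Q.2 fun h' => h (Subtype.ext h')).mono (Tritile.tile_toSet_subset _ _)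
      (Tritile.tile_toSet_subset _ _)
  have hTne : ∀ P, (T P).toSet.Nonempty := fun P =>
    ⟨((T P).time.center, (T P).freq.center), (T P).time.center_mem, (T P).freq.center_mem⟩
  have hTinj : Function.Injective T := by
    intro P Q h
    by_contra hne
    have := hTd P Q hne
    rw [h, disjoint_self] at this
    exact (hTne Q).ne_empty this
  have h2 := hC (s.map ⟨T, hTinj⟩) (by
    intro P hP Q hQ hne
    obtain ⟨P', -, rfl⟩ := Finset.mem_map.1 hP
    obtain ⟨Q', -, rfl⟩ := Finset.mem_map.1 hQ
    exact hTd P' Q' fun h => hne (by rw [h])) f hf τ hτ (by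
    intro P hP
    obtain ⟨P', -, rfl⟩ := Finset.mem_map.1 hP
    exact hw P' (hME P'.2))
  rw [Finset.sum_map] at h2
  exact h2

/-! ### Bad intervals -/

/-- The intervals on which the mean of `u` exceeds `L`. -/
def highMean (u : Walsh → ℝ≥0∞) (L : ℝ≥0∞) : Set WInterval :=
  {J | L * J.length < ∫⁻ x in J.toSet, u x}

/-- Finite total mass rules out a high mean on long intervals; hence maximal bad intervals exist. -/
theorem exists_scale_bound_highMean {u : Walsh → ℝ≥0∞} {L : ℝ≥0∞} (hL : L ≠ 0)
    (hu : ∫⁻ x, u x ≠ ∞) : ∃ n : ℤ, ∀ J ∈ highMean u L, J.scale ≤ n := by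
  obtain ⟨n, hn⟩ : ∃ n : ℕ, (∫⁻ x, u x) / L < n :=
    ENNReal.exists_nat_gt (ENNReal.div_ne_top hu hL)
  refine ⟨n, fun J hJ => ?_⟩
  by_contra! hcon
  have h1 : L * J.length < ∫⁻ x, u x := lt_of_lt_of_le hJ (setLIntegral_le_lintegral _ _)
  have h2 : (J.length : ℝ≥0∞) ≤ (∫⁻ x, u x) / L := by
    rw [ENNReal.le_div_iff_mul_le (Or.inl hL) (Or.inr hu), mul_comm]
    exact h1.le
  have h3 : (n : ℝ≥0) ≤ J.length := by
    calc (n : ℝ≥0) ≤ 3 ^ n := by exact_mod_cast (Nat.lt_pow_self (by norm_num)).le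
      _ = 3 ^ (n : ℤ) := (zpow_natCast _ _).symm
      _ ≤ _ := zpow_le_zpow_right₀ (by norm_num) hcon.le
  have h4 : (n : ℝ≥0∞) ≤ J.length := by exact_mod_cast h3
  exact absurd (h4.trans h2) (not_le.2 hn)

/-- The tritiles over intervals on which the mean of `u` exceeds `L`. -/
def highTritiles (u : Walsh → ℝ≥0∞) (L : ℝ≥0∞) : Set Tritile :=
  {P | ∃ J ∈ highMean u L, P.time.toSet ⊆ J.toSet}

/-- A weak-type bound for the dyadic maximal function, in terms of strips. -/
theorem outerMeasure_highTritiles_mul_le {q : ℝ≥0∞} {u w : Walsh → ℝ≥0∞} {L : ℝ≥0∞}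
    (hL : L ≠ 0) (hLt : L ≠ ∞) (hu : ∫⁻ x, u x ≠ ∞) (huw : ∀ x, u x ≤ w x + L / 2)
    (hw : Measurable w) :
    (stripLqSInfty q).outerMeasure (highTritiles u L) * (L / 2) ≤ ∫⁻ x, w x := by
  obtain ⟨n, hn⟩ := exists_scale_bound_highMean hL hu
  obtain ⟨M, hMB, hdisj, hcov⟩ := exists_maximal_intervals _ hn
  have h1 := (stripLqSInfty q).outerMeasure_le_tsum (A := highTritiles u L) M M.to_countable (by
    rintro P ⟨J, hJ, hPJ⟩
    obtain ⟨J', hJ', hJJ⟩ := hcov J hJ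
    exact mem_iUnion₂.2 ⟨J', hJ', hPJ.trans hJJ⟩)
  refine (mul_le_mul_left h1 _).trans ?_
  change (∑' J : M, ((J : WInterval).length : ℝ≥0∞)) * (L / 2) ≤ _
  rw [← ENNReal.tsum_mul_right]
  -- The mean of `u` on `J` exceeds `L` and at most `L / 2` of it comes from the constant, so `w`
  -- carries the rest.
  have h2 : ∀ J : M, ((J : WInterval).length : ℝ≥0∞) * (L / 2) ≤
      ∫⁻ x in (J : WInterval).toSet, w x := by
    intro J
    have h3 : L * (J : WInterval).length ≤
        (∫⁻ x in (J : WInterval).toSet, w x) + L / 2 * (J : WInterval).length := by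
      calc L * (J : WInterval).length ≤ ∫⁻ x in (J : WInterval).toSet, u x := (hMB J.2).le
        _ ≤ ∫⁻ x in (J : WInterval).toSet, (w x + L / 2) := lintegral_mono fun x => huw x
        _ = _ := by
          rw [lintegral_add_left hw, setLIntegral_const, WInterval.volume_toSet]
    have h4 : L * (J : WInterval).length =
        (J : WInterval).length * (L / 2) + L / 2 * (J : WInterval).length := by
      rw [mul_comm _ (L / 2), ← add_mul, ENNReal.add_halves]
    rw [h4] at h3
    refine (ENNReal.add_le_add_iff_right ?_).1 h3
    exact ENNReal.mul_ne_top (ENNReal.div_ne_top hLt two_ne_zero) ENNReal.coe_ne_top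
  refine (ENNReal.tsum_le_tsum h2).trans ?_
  rw [← lintegral_iUnion (s := fun J : M => (J : WInterval).toSet)
    (fun J => (J : WInterval).measurableSet_toSet) (by
      intro J J' hne
      exact hdisj J J.2 J' J'.2 fun h => hne (Subtype.ext h))]
  exact setLIntegral_le_lintegral _ _

/-! ### Size estimates outside the bad strips -/

theorem lintegral_Ioo_rpow {a R : ℝ} (ha : 0 < a) (hR : 0 ≤ R) :
    ∫⁻ t in Ioo (0 : ℝ) R, ENNReal.ofReal (t ^ (a - 1)) = ENNReal.ofReal (R ^ a / a) := by
  have h1 : IntervalIntegrable (fun t : ℝ => t ^ (a - 1)) volume 0 R :=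
    intervalIntegral.intervalIntegrable_rpow' (by linarith)
  have h2 : IntegrableOn (fun t : ℝ => t ^ (a - 1)) (Ioc 0 R) :=
    (intervalIntegrable_iff_integrableOn_Ioc_of_le hR).1 h1
  rw [restrict_Ioo_eq_restrict_Ioc, ← ofReal_integral_eq_lintegral_ofReal h2]
  · rw [← intervalIntegral.integral_of_le hR, integral_rpow (Or.inl (by linarith))]
    rw [sub_add_cancel, Real.zero_rpow ha.ne', sub_zero]
  · filter_upwards [ae_restrict_mem measurableSet_Ioc] with t ht
    exact Real.rpow_nonneg ht.1.le _

section Pairing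

variable {X : Type*} [NormedAddCommGroup X]

theorem enorm_rpow_eq_ofReal (v : X) {s : ℝ} (hs : 0 ≤ s) :
    ‖v‖ₑ ^ s = ENNReal.ofReal (‖v‖ ^ s) := by
  rw [← ENNReal.ofReal_rpow_of_nonneg (norm_nonneg _) hs, ofReal_norm]

theorem enorm_le_mul_rpow_of_lt {v : X} {Λ s : ℝ} (hΛ : 0 < Λ) (hs : 1 ≤ s) (hv : Λ < ‖v‖) :
    ‖v‖ₑ ≤ ENNReal.ofReal (Λ ^ (1 - s)) * ‖v‖ₑ ^ s := by
  have hv0 : 0 < ‖v‖ := hΛ.trans hv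
  rw [enorm_rpow_eq_ofReal v (by linarith), ← ENNReal.ofReal_mul (by positivity), ← ofReal_norm]
  refine ENNReal.ofReal_le_ofReal ?_
  calc ‖v‖ = ‖v‖ ^ (1 - s) * ‖v‖ ^ s := by
        rw [← Real.rpow_add hv0, sub_add_cancel, Real.rpow_one]
    _ ≤ Λ ^ (1 - s) * ‖v‖ ^ s :=
        mul_le_mul_of_nonneg_right (Real.rpow_le_rpow_of_nonpos hΛ hv.le (by linarith))
          (by positivity)

theorem enorm_rpow_le_mul_rpow_of_le {v : X} {Λ r s : ℝ} (hs : 0 < s) (hsr : s ≤ r)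
    (hv : ‖v‖ ≤ Λ) : ‖v‖ₑ ^ r ≤ ENNReal.ofReal (Λ ^ (r - s)) * ‖v‖ₑ ^ s := by
  rcases (norm_nonneg v).eq_or_lt with h0 | h0
  · have : ‖v‖ₑ = 0 := by rw [← ofReal_norm, ← h0, ENNReal.ofReal_zero]
    rw [this, ENNReal.zero_rpow_of_pos (hs.trans_le hsr)]
    exact zero_le
  have hΛ : 0 < Λ := h0.trans_le hv
  rw [enorm_rpow_eq_ofReal v (by linarith), enorm_rpow_eq_ofReal v hs.le,
    ← ENNReal.ofReal_mul (by positivity)]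
  refine ENNReal.ofReal_le_ofReal ?_
  calc ‖v‖ ^ r = ‖v‖ ^ (r - s) * ‖v‖ ^ s := by rw [← Real.rpow_add h0, sub_add_cancel]
    _ ≤ _ := mul_le_mul_of_nonneg_right (Real.rpow_le_rpow h0.le hv (by linarith))
          (by positivity)

variable [NormedSpace ℂ X]

theorem integrable_wavePacket_smul (P : Tile) {f : Walsh → X} (hf : Integrable f volume) :
    Integrable (fun x => P.wavePacket x • f x) volume := by
  refine Integrable.mono' (hf.norm.const_mul (P.time.length : ℝ)⁻¹)
    (P.measurable_wavePacket.aestronglyMeasurable.smul hf.aestronglyMeasurable)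
    (Eventually.of_forall fun x => ?_)
  rw [norm_smul]
  exact mul_le_mul_of_nonneg_right (P.norm_wavePacket_le x) (norm_nonneg _)

/-- Perturbation of a wave packet coefficient. -/
theorem enorm_walshPairing_le_add (P : Tile) {f g : Walsh → X} (hf : Integrable f volume)
    (hg : Integrable g volume) {s : ℝ} {a b L : ℝ≥0∞} (hb : b ≠ ∞)
    (hfg : ∀ x ∈ P.time.toSet, ‖f x - g x‖ₑ ≤ a + b * ‖f x‖ₑ ^ s)
    (hL : ∫⁻ x in P.time.toSet, ‖f x‖ₑ ^ s ≤ L * P.time.length) :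
    ‖walshPairing f P.wavePacket‖ₑ ≤ ‖walshPairing g P.wavePacket‖ₑ + (a + b * L) := by
  have hl0 : (P.time.length : ℝ≥0∞) ≠ 0 := by exact_mod_cast P.time.length_pos.ne'
  have h1 : walshPairing f P.wavePacket =
      walshPairing g P.wavePacket + ∫ x, P.wavePacket x • (f x - g x) := by
    simp only [walshPairing, smul_sub]
    rw [integral_sub (integrable_wavePacket_smul P hf) (integrable_wavePacket_smul P hg)]
    abel
  rw [h1]
  refine (enorm_add_le _ _).trans (add_le_add le_rfl ?_)
  refine (enorm_integral_le_lintegral_enorm _).trans ?_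
  have h2 : ∀ x, ‖P.wavePacket x • (f x - g x)‖ₑ ≤
      P.time.toSet.indicator (fun x => (P.time.length : ℝ≥0∞)⁻¹ * (a + b * ‖f x‖ₑ ^ s)) x := by
    intro x
    rw [enorm_smul, P.enorm_wavePacket]
    by_cases hx : x ∈ P.time.toSet
    · simp only [indicator_of_mem hx]
      exact mul_le_mul_right (hfg x hx) _
    · simp [indicator_of_notMem hx]
  refine (lintegral_mono h2).trans ?_
  rw [lintegral_indicator P.time.measurableSet_toSet,
    lintegral_const_mul' _ _ (ENNReal.inv_ne_top.2 hl0), lintegral_add_left measurable_const,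
    lintegral_const_mul' _ _ hb, setLIntegral_const, WInterval.volume_toSet]
  calc (P.time.length : ℝ≥0∞)⁻¹ * (a * P.time.length +
        b * ∫⁻ x in P.time.toSet, ‖f x‖ₑ ^ s)
      ≤ (P.time.length : ℝ≥0∞)⁻¹ * (a * P.time.length + b * (L * P.time.length)) := by gcongr
    _ = ((P.time.length : ℝ≥0∞)⁻¹ * P.time.length) * (a + b * L) := by ring
    _ = a + b * L := by rw [ENNReal.inv_mul_cancel hl0 ENNReal.coe_ne_top, one_mul]

/-- A tritile that survives the removal controls the mean on every larger interval, in particular on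
the top of any strip containing it. -/
theorem lintegral_le_of_notMem_highTritiles {u : Walsh → ℝ≥0∞} {L : ℝ≥0∞} {P : Tritile}
    (hP : P ∉ highTritiles u L) {J : WInterval} (hJ : P.time.toSet ⊆ J.toSet) :
    ∫⁻ x in J.toSet, u x ≤ L * J.length := by
  by_contra! h
  exact hP ⟨J, h, hJ⟩

/-- Outside the bad strips the embedding is bounded. -/
theorem norm_walshEmbedding_le (f : Walsh → X) (hf : Integrable f volume) {s l : ℝ}
    (hs : 1 ≤ s) (hl : 0 < l) {P : Tritile}
    (hP : P ∉ highTritiles (fun x => ‖f x‖ₑ ^ s) (ENNReal.ofReal (l ^ s))) :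
    ‖walshEmbedding f P‖ ≤ 2 * l := by
  refine (pi_norm_le_iff_of_nonneg (by positivity)).2 fun w => ?_
  -- Comparison with zero: `‖f‖ ≤ l + l ^ (1 - s) * ‖f‖ ^ s`, and each summand has mean at most `l`
  -- on `I_P`.
  have h := enorm_walshPairing_le_add (P.tile w) hf (integrable_zero _ _ _) (s := s)
    (a := ENNReal.ofReal l) (b := ENNReal.ofReal (l ^ (1 - s)))
    (L := ENNReal.ofReal (l ^ s)) ENNReal.ofReal_ne_top (fun x _ => by
      rw [Pi.zero_apply, sub_zero]
      rcases le_or_gt ‖f x‖ l with hx | hx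
      · rw [← ofReal_norm]
        exact (ENNReal.ofReal_le_ofReal hx).trans le_self_add
      · exact (enorm_le_mul_rpow_of_lt hl hs hx).trans le_add_self)
    (lintegral_le_of_notMem_highTritiles hP subset_rfl)
  have h0 : walshPairing (0 : Walsh → X) (P.tile w).wavePacket = 0 := by
    simp [walshPairing]
  rw [h0, enorm_zero, zero_add, ← ENNReal.ofReal_mul (by positivity), ← Real.rpow_add hl,
    sub_add_cancel, Real.rpow_one, ← ENNReal.ofReal_add hl.le hl.le, ← ofReal_norm,
    ENNReal.ofReal_le_ofReal_iff (by positivity)] at h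
  rw [two_mul]
  exact h

/-- The level sets of the embedding outside the bad strips. -/
theorem outerMeasure_level_le {r s : ℝ} (hs : 1 < s) (hsr : s ≤ r) {C : ℝ≥0}
    (hC : ∀ g : SimpleFunc Walsh X, Integrable g volume → ∀ τ : ℝ, 0 < τ →
      ∀ (E : Set Tritile) (n : ℤ), (∀ P ∈ E, P.time.scale ≤ n) →
      (∀ P ∈ E, ∃ w, τ ≤ ‖walshPairing g (P.tile w).wavePacket‖) →
      treeSInfty.outerMeasure E * ENNReal.ofReal (τ ^ r) ≤ C * ∫⁻ x, ‖g x‖ₑ ^ r)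
    (f : SimpleFunc Walsh X) (hf : Integrable f volume) (I : WInterval) {l τ : ℝ}
    (hl : 0 < l) (hτ : 0 < τ) :
    treeSInfty.outerMeasure {P | P ∈ strip I ∧
      P ∉ highTritiles (fun x => ‖f x‖ₑ ^ s) (ENNReal.ofReal (l ^ s)) ∧
      τ < ‖walshEmbedding f P‖} ≤
      C * ENNReal.ofReal ((2 * l / τ) ^ (s * (r - 1) / (s - 1))) * I.length := by
  classical
  set u : Walsh → ℝ≥0∞ := fun x => ‖f x‖ₑ ^ s with hu
  set E : Set Tritile := {P | P ∈ strip I ∧ P ∉ highTritiles u (ENNReal.ofReal (l ^ s)) ∧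
    τ < ‖walshEmbedding f P‖} with hE
  rcases E.eq_empty_or_nonempty with hE0 | ⟨P₀, hP₀⟩
  · rw [hE0, treeSInfty.outerMeasure_empty]
    exact zero_le
  have hIu := lintegral_le_of_notMem_highTritiles hP₀.2.1 hP₀.1
  have hs0 : 0 < s := by linarith
  have hs1 : 0 < s - 1 := by linarith
  set x : ℝ := 2 * l / τ with hx
  have hx0 : 0 < x := by positivity
  -- The height that solves `Λ ^ (1 - s) * l ^ s = τ / 2`: discarding the values above `Λ` changes
  -- no coefficient of `E` by more than `τ / 2`.
  set Λ : ℝ := l * x ^ (1 / (s - 1)) with hΛ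
  have hΛ0 : 0 < Λ := by positivity
  have hΛpow : ∀ y : ℝ, Λ ^ y = l ^ y * x ^ (y / (s - 1)) := fun y => by
    rw [hΛ, Real.mul_rpow hl.le (by positivity), ← Real.rpow_mul hx0.le]
    congr 2
    ring
  have hτx : τ / 2 = l * x⁻¹ := by
    rw [hx]
    field_simp
  set g : SimpleFunc Walsh X := (f.map fun v => if ‖v‖ ≤ Λ then v else 0).restrict I.toSet with hg
  have hgval : ∀ y, g y = I.toSet.indicator (fun y => if ‖f y‖ ≤ Λ then f y else 0) y := by
    intro y
    rw [hg, SimpleFunc.restrict_apply _ I.measurableSet_toSet]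
    rfl
  have hgf : ∀ y, ‖g y‖ ≤ ‖f y‖ := by
    intro y
    rw [hgval]
    refine (norm_indicator_le_norm_self _ _).trans ?_
    split_ifs
    · exact le_rfl
    · simp
  have hgi : Integrable g volume :=
    hf.mono g.aestronglyMeasurable (Eventually.of_forall hgf)
  have hEw : ∀ P ∈ E, ∃ w, τ / 2 ≤ ‖walshPairing g (P.tile w).wavePacket‖ := by
    intro P hP
    obtain ⟨w, hw⟩ : ∃ w, τ < ‖walshEmbedding f P w‖ := by
      by_contra! hcon
      exact absurd hP.2.2 (not_lt.2 ((pi_norm_le_iff_of_nonneg hτ.le).2 hcon))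
    refine ⟨w, ?_⟩
    have h := enorm_walshPairing_le_add (P.tile w) hf hgi (s := s) (a := 0)
      (b := ENNReal.ofReal (Λ ^ (1 - s))) (L := ENNReal.ofReal (l ^ s)) ENNReal.ofReal_ne_top
      (fun y hy => by
        rw [hgval, indicator_of_mem (hP.1 hy), zero_add]
        split_ifs with hy'
        · simp
        · rw [sub_zero]
          exact enorm_le_mul_rpow_of_lt hΛ0 hs.le (not_le.1 hy'))
      (lintegral_le_of_notMem_highTritiles hP.2.1 subset_rfl)
    have hval : Λ ^ (1 - s) * l ^ s = τ / 2 := by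
      rw [hΛpow, hτx, show (1 - s) / (s - 1) = -1 by field_simp; ring, Real.rpow_neg_one,
        mul_right_comm, ← Real.rpow_add hl, sub_add_cancel, Real.rpow_one]
    rw [zero_add, ← ENNReal.ofReal_mul (by positivity), hval, ← ofReal_norm, ← ofReal_norm,
      ← ENNReal.ofReal_add (norm_nonneg _) (by positivity),
      ENNReal.ofReal_le_ofReal_iff (by positivity)] at h
    have hw' : τ < ‖walshPairing f (P.tile w).wavePacket‖ := hw
    linarith
  have hmain := hC g hgi (τ / 2) (by positivity) E I.scale
    (fun P hP => WInterval.scale_le_of_subset hP.1) hEw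
  have hgr : ∫⁻ y, ‖g y‖ₑ ^ r ≤
      ENNReal.ofReal (Λ ^ (r - s)) * (ENNReal.ofReal (l ^ s) * I.length) := by
    have h1 : ∀ y, ‖g y‖ₑ ^ r ≤ I.toSet.indicator
        (fun y => ENNReal.ofReal (Λ ^ (r - s)) * u y) y := by
      intro y
      have hr0 : 0 < r := by linarith
      rw [hgval]
      by_cases hy : y ∈ I.toSet
      · simp only [indicator_of_mem hy]
        split_ifs with hy'
        · exact enorm_rpow_le_mul_rpow_of_le hs0 hsr hy'
        · rw [enorm_zero, ENNReal.zero_rpow_of_pos hr0]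
          exact zero_le
      · simp only [indicator_of_notMem hy]
        rw [enorm_zero, ENNReal.zero_rpow_of_pos hr0]
    refine (lintegral_mono h1).trans ?_
    rw [lintegral_indicator I.measurableSet_toSet, lintegral_const_mul' _ _ ENNReal.ofReal_ne_top]
    exact mul_le_mul_right hIu _
  -- The weak-type exponent arises as `r + (r - s) / (s - 1)`.
  have hexp : Λ ^ (r - s) * l ^ s = x ^ (s * (r - 1) / (s - 1)) * (τ / 2) ^ r := by
    rw [hΛpow, hτx, Real.mul_rpow hl.le (by positivity), Real.inv_rpow hx0.le,
      ← Real.rpow_neg hx0.le, mul_right_comm, ← Real.rpow_add hl, sub_add_cancel, mul_left_comm,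
      ← Real.rpow_add hx0]
    congr 2
    field_simp
    ring
  have hpos : ENNReal.ofReal ((τ / 2) ^ r) ≠ 0 := by
    rw [Ne, ENNReal.ofReal_eq_zero, not_le]
    positivity
  refine (ENNReal.mul_le_mul_iff_left hpos ENNReal.ofReal_ne_top).1 ?_
  refine hmain.trans ((mul_le_mul_right hgr _).trans_eq ?_)
  rw [← mul_assoc (ENNReal.ofReal (Λ ^ (r - s))), ← ENNReal.ofReal_mul (by positivity), hexp,
    ENNReal.ofReal_mul (by positivity)]
  ring

end Pairing

/-! ### The averaged size on strips -/

theorem treeSInfty_supSize_le {G : Tritile → ℂ} {t : ℝ≥0∞} (h : ∀ P, ‖G P‖ₑ ≤ t) :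
    treeSInfty.supSize G ≤ t :=
  iSup_le fun _ => iSup₂_le fun Q _ => h Q

theorem treeSInfty_superlevel_le (G : Tritile → ℂ) (t : ℝ) :
    treeSInfty.superlevel G t ≤ treeSInfty.outerMeasure {P | t < ‖G P‖} := by
  refine treeSInfty.superlevel_le _ (treeSInfty_supSize_le fun P => ?_)
  by_cases hP : t < ‖G P‖
  · rw [indicator_of_notMem (by simpa using hP), enorm_zero]
    exact zero_le
  · rw [indicator_of_mem (by simpa using hP), ← ofReal_norm]
    exact ENNReal.ofReal_le_ofReal (not_lt.1 hP)

/-- A weak-type bound of exponent below `q` for a bounded function on a strip gives a bound on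
its averaged outer-`L^q` size. -/
theorem exists_averaged_size_bound {q₀ : ℝ} (hq₀ : 0 < q₀) {q : ℝ≥0∞}
    (hq : ENNReal.ofReal q₀ < q) (C : ℝ≥0) :
    ∃ B : ℝ, 0 < B ∧ ∀ (G : Tritile → ℂ) (I : WInterval) (l : ℝ), 0 < l →
      (∀ P, ‖G P‖ ≤ 2 * l) →
      (∀ τ : ℝ, 0 < τ → treeSInfty.outerMeasure {P | τ < ‖G P‖} ≤
        C * ENNReal.ofReal ((2 * l / τ) ^ q₀) * I.length) →
      (I.length : ℝ≥0∞) ^ (-(q⁻¹).toReal) * treeSInfty.outerLp q G ≤ ENNReal.ofReal (B * l) := by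
  rcases eq_or_ne q ∞ with rfl | hqt
  · refine ⟨2, two_pos, fun G I l _ hG _ => ?_⟩
    rw [OuterData.outerLp, if_pos rfl, ENNReal.inv_top, ENNReal.toReal_zero, neg_zero,
      ENNReal.rpow_zero, one_mul]
    refine treeSInfty_supSize_le fun P => ?_
    rw [← ofReal_norm]
    exact ENNReal.ofReal_le_ofReal (hG P)
  set a := q.toReal with ha
  have hqa : q₀ < a := (ENNReal.ofReal_lt_iff_lt_toReal hq₀.le hqt).1 hq
  have ha0 : 0 < a := hq₀.trans hqa
  set K : ℝ := (C * (a / (a - q₀))) ^ (1 / a) with hK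
  have haq : 0 < a - q₀ := by linarith
  have hK0 : 0 ≤ K := by positivity
  -- The layer-cake integral runs only over `t < 2 * l`, as the level sets are empty beyond; it
  -- converges at `0` because `q₀ < a`. The summand `1` only makes the constant positive.
  refine ⟨2 * K + 1, by positivity, fun G I l hl hG hlev => ?_⟩
  have hI0 : (I.length : ℝ≥0∞) ≠ 0 := by exact_mod_cast I.length_pos.ne'
  have hl2 : 0 < 2 * l := by positivity
  rw [OuterData.outerLp, if_neg hqt, ← ha]
  have hint : ∫⁻ t in Ioi (0 : ℝ), ENNReal.ofReal (a * t ^ (a - 1)) * treeSInfty.superlevel G t ≤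
      ENNReal.ofReal (C * (a / (a - q₀))) * ENNReal.ofReal ((2 * l) ^ a) * I.length := by
    have hpt : ∀ t ∈ Ioi (0 : ℝ),
        ENNReal.ofReal (a * t ^ (a - 1)) * treeSInfty.superlevel G t ≤
          (Ioo 0 (2 * l)).indicator (fun t => (ENNReal.ofReal (C * a * (2 * l) ^ q₀) * I.length) *
            ENNReal.ofReal (t ^ (a - q₀ - 1))) t := by
      intro t ht
      have ht0 : 0 < t := ht
      by_cases htl : t < 2 * l
      · rw [indicator_of_mem (show t ∈ Ioo 0 (2 * l) from ⟨ht0, htl⟩)]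
        refine (mul_le_mul_right ((treeSInfty_superlevel_le G t).trans (hlev t ht0)) _).trans_eq ?_
        rw [← ENNReal.ofReal_coe_nnreal (p := C), mul_right_comm _ (I.length : ℝ≥0∞),
          ← ENNReal.ofReal_mul (by positivity), ← ENNReal.ofReal_mul (by positivity), ← mul_assoc,
          ← ENNReal.ofReal_mul (by positivity)]
        congr 2
        rw [Real.div_rpow hl2.le ht0.le, show a - q₀ - 1 = (a - 1) - q₀ by ring,
          Real.rpow_sub ht0 (a - 1) q₀]
        ring
      · have h0 : {P | t < ‖G P‖} = ∅ := by
          refine eq_empty_of_forall_notMem fun P hP => htl ?_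
          exact lt_of_lt_of_le hP (hG P)
        have h1 := treeSInfty_superlevel_le G t
        rw [h0, treeSInfty.outerMeasure_empty] at h1
        rw [le_antisymm h1 zero_le, mul_zero]
        exact zero_le
    refine (setLIntegral_mono' measurableSet_Ioi hpt).trans ?_
    rw [lintegral_indicator measurableSet_Ioo, Measure.restrict_restrict measurableSet_Ioo,
      inter_eq_self_of_subset_left Ioo_subset_Ioi_self,
      lintegral_const_mul' _ _ (ENNReal.mul_ne_top ENNReal.ofReal_ne_top ENNReal.coe_ne_top),
      lintegral_Ioo_rpow haq hl2.le, mul_right_comm, ← ENNReal.ofReal_mul (by positivity),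
      ← ENNReal.ofReal_mul (by positivity)]
    refine le_of_eq ?_
    congr 2
    rw [Real.rpow_sub hl2]
    field_simp
  have hlen : (I.length : ℝ≥0∞) ^ (-(q⁻¹).toReal) * (I.length : ℝ≥0∞) ^ (1 / a) = 1 := by
    rw [← ENNReal.rpow_add _ _ hI0 ENNReal.coe_ne_top, ENNReal.toReal_inv, ← ha, one_div,
      neg_add_cancel, ENNReal.rpow_zero]
  refine (mul_le_mul_right (ENNReal.rpow_le_rpow hint (by positivity)) _).trans ?_
  rw [ENNReal.mul_rpow_of_nonneg _ _ (by positivity),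
    ENNReal.mul_rpow_of_nonneg _ _ (by positivity),
    mul_comm, mul_assoc, mul_comm ((I.length : ℝ≥0∞) ^ (1 / a)), hlen, mul_one,
    ENNReal.ofReal_rpow_of_nonneg (by positivity) (by positivity),
    ENNReal.ofReal_rpow_of_nonneg (by positivity) (by positivity), ← Real.rpow_mul hl2.le,
    mul_one_div_cancel ha0.ne', Real.rpow_one, ← ENNReal.ofReal_mul hK0]
  refine ENNReal.ofReal_le_ofReal ?_
  nlinarith

/-! ### The embedding bound -/

/-- Integration of the maximal estimate over all levels. -/
theorem lintegral_maximal_le {X : Type*} [NormedAddCommGroup X] {p s B : ℝ}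
    (hs : 0 < s) (hsp : s < p) (hB : 0 < B) (f : SimpleFunc Walsh X) :
    ∫⁻ t in Ioi (0 : ℝ), ENNReal.ofReal (p * t ^ (p - 1)) *
      (ENNReal.ofReal (2 * (t / B) ^ (-s)) *
        ∫⁻ x, {x | t / B / 2 < ‖f x‖}.indicator (fun x => ‖f x‖ₑ ^ s) x) ≤
      ENNReal.ofReal (2 * p * B ^ s * ((2 * B) ^ (p - s) / (p - s))) * ∫⁻ x, ‖f x‖ₑ ^ p := by
  have hp : 0 < p := hs.trans hsp
  have hps : 0 < p - s := by linarith
  have hnorm : Measurable fun x => ‖f x‖ := (f.map norm).measurable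
  have henorm : Measurable fun x => ‖f x‖ₑ := (f.map enorm).measurable
  -- For fixed `x` only levels `t < 2 * B * ‖f x‖` contribute, and `t ^ (p - s - 1)` is integrable
  -- at `0` since `s < p`.
  set k : ℝ → Walsh → ℝ≥0∞ := fun t x =>
    (Ioo 0 (2 * B * ‖f x‖)).indicator (fun t => ENNReal.ofReal (t ^ (p - s - 1))) t *
      (ENNReal.ofReal (2 * p * B ^ s) * ‖f x‖ₑ ^ s) with hk
  have hkm : Measurable (Function.uncurry k) := by
    have hset : MeasurableSet {z : ℝ × Walsh | z.1 ∈ Ioo 0 (2 * B * ‖f z.2‖)} :=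
      (measurableSet_lt measurable_const measurable_fst).inter
        (measurableSet_lt measurable_fst ((hnorm.comp measurable_snd).const_mul _))
    have h1 : Measurable ({z : ℝ × Walsh | z.1 ∈ Ioo 0 (2 * B * ‖f z.2‖)}.indicator
        fun z => ENNReal.ofReal (z.1 ^ (p - s - 1))) :=
      (by fun_prop : Measurable fun z : ℝ × Walsh => ENNReal.ofReal (z.1 ^ (p - s - 1))).indicator
        hset
    exact h1.mul (((henorm.comp measurable_snd).pow_const s).const_mul _)
  have hpt : ∀ t ∈ Ioi (0 : ℝ), ENNReal.ofReal (p * t ^ (p - 1)) *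
      (ENNReal.ofReal (2 * (t / B) ^ (-s)) *
        ∫⁻ x, {x | t / B / 2 < ‖f x‖}.indicator (fun x => ‖f x‖ₑ ^ s) x) ≤ ∫⁻ x, k t x := by
    intro t ht
    have ht0 : 0 < t := ht
    rw [← mul_assoc, ← ENNReal.ofReal_mul (by positivity),
      ← lintegral_const_mul' _ _ ENNReal.ofReal_ne_top]
    refine lintegral_mono fun x => ?_
    by_cases hx : t / B / 2 < ‖f x‖
    · have hx' : t ∈ Ioo 0 (2 * B * ‖f x‖) := by
        refine ⟨ht0, ?_⟩
        rw [div_div, div_lt_iff₀ (by positivity)] at hx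
        linarith
      simp only [hk]
      rw [indicator_of_mem (show x ∈ {x | t / B / 2 < ‖f x‖} from hx), indicator_of_mem hx',
        ← mul_assoc (ENNReal.ofReal (t ^ (p - s - 1))), ← ENNReal.ofReal_mul (by positivity)]
      refine le_of_eq ?_
      congr 2
      rw [Real.div_rpow ht0.le hB.le, Real.rpow_neg hB.le, show p - s - 1 = (p - 1) + -s by ring,
        Real.rpow_add ht0]
      field_simp
    · rw [indicator_of_notMem (show x ∉ {x | t / B / 2 < ‖f x‖} from hx), mul_zero]
      exact zero_le
  refine (setLIntegral_mono' measurableSet_Ioi hpt).trans ?_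
  rw [lintegral_lintegral_swap hkm.aemeasurable, ← lintegral_const_mul' _ _ ENNReal.ofReal_ne_top]
  refine lintegral_mono fun x => ?_
  have hR : 0 ≤ 2 * B * ‖f x‖ := by positivity
  simp only [hk]
  rw [lintegral_mul_const' _ _ (ENNReal.mul_ne_top ENNReal.ofReal_ne_top
      (ENNReal.rpow_ne_top_of_nonneg hs.le enorm_ne_top)),
    lintegral_indicator measurableSet_Ioo, Measure.restrict_restrict measurableSet_Ioo,
    inter_eq_self_of_subset_left Ioo_subset_Ioi_self, lintegral_Ioo_rpow hps hR,
    enorm_rpow_eq_ofReal _ hs.le, enorm_rpow_eq_ofReal _ hp.le, ← ENNReal.ofReal_mul (by positivity),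
    ← ENNReal.ofReal_mul (by positivity), ← ENNReal.ofReal_mul (by positivity)]
  refine le_of_eq ?_
  congr 1
  rw [Real.mul_rpow (by positivity) (norm_nonneg _)]
  have : ‖f x‖ ^ p = ‖f x‖ ^ (p - s) * ‖f x‖ ^ s := by
    rcases (norm_nonneg (f x)).eq_or_lt with h0 | h0
    · rw [← h0, Real.zero_rpow hp.ne', Real.zero_rpow hs.ne', mul_zero]
    · rw [← Real.rpow_add h0, sub_add_cancel]
  rw [this]
  ring

section Embedding

variable {X : Type*} [NormedAddCommGroup X] [NormedSpace ℂ X]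

/-- The superlevel measure of the embedding is controlled by the maximal function. -/
theorem superlevel_walshEmbedding_le {r s B : ℝ} (hs : 1 < s) (hsr : s ≤ r)
    {q : ℝ≥0∞} {C : ℝ≥0}
    (hC : ∀ g : SimpleFunc Walsh X, Integrable g volume → ∀ τ : ℝ, 0 < τ →
      ∀ (E : Set Tritile) (n : ℤ), (∀ P ∈ E, P.time.scale ≤ n) →
      (∀ P ∈ E, ∃ w, τ ≤ ‖walshPairing g (P.tile w).wavePacket‖) →
      treeSInfty.outerMeasure E * ENNReal.ofReal (τ ^ r) ≤ C * ∫⁻ x, ‖g x‖ₑ ^ r)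
    (hsize : ∀ (G : Tritile → ℂ) (I : WInterval) (l : ℝ), 0 < l → (∀ P, ‖G P‖ ≤ 2 * l) →
      (∀ τ : ℝ, 0 < τ → treeSInfty.outerMeasure {P | τ < ‖G P‖} ≤
        C * ENNReal.ofReal ((2 * l / τ) ^ (s * (r - 1) / (s - 1))) * I.length) →
      (I.length : ℝ≥0∞) ^ (-(q⁻¹).toReal) * treeSInfty.outerLp q G ≤ ENNReal.ofReal (B * l))
    (f : SimpleFunc Walsh X) (hf : Integrable f volume) {l : ℝ} (hl : 0 < l) :
    (stripLqSInfty q).superlevel (fun P => ((‖walshEmbedding f P‖ : ℝ) : ℂ)) (B * l) ≤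
      ENNReal.ofReal (2 * l ^ (-s)) *
        ∫⁻ x, {x | l / 2 < ‖f x‖}.indicator (fun x => ‖f x‖ₑ ^ s) x := by
  have hs0 : 0 < s := by linarith
  set u : Walsh → ℝ≥0∞ := fun x => ‖f x‖ₑ ^ s with hu
  set L : ℝ≥0∞ := ENNReal.ofReal (l ^ s) with hL
  have hls : 0 < l ^ s := by positivity
  have hnorm : Measurable fun x => ‖f x‖ := (f.map norm).measurable
  have henorm : Measurable fun x => ‖f x‖ₑ := (f.map enorm).measurable
  have hum : Measurable u := henorm.pow_const s
  have hufin : ∫⁻ x, u x ≠ ∞ := by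
    have hmem : MemLp f (ENNReal.ofReal s) volume :=
      SimpleFunc.memLp_of_finite_measure_preimage _
        (SimpleFunc.finMeasSupp_iff.1 (SimpleFunc.integrable_iff_finMeasSupp.1 hf))
    have := lintegral_rpow_enorm_lt_top_of_eLpNorm_lt_top (by simpa using hs0)
      ENNReal.ofReal_ne_top hmem.2
    rw [ENNReal.toReal_ofReal hs0.le] at this
    exact this.ne
  have h1 : (stripLqSInfty q).superlevel (fun P => ((‖walshEmbedding f P‖ : ℝ) : ℂ)) (B * l) ≤
      (stripLqSInfty q).outerMeasure (highTritiles u L) := by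
    -- The bad tritiles serve as exceptional set; off them every strip has averaged size at most `B
    -- * l`.
    refine (stripLqSInfty q).superlevel_le _ (iSup_le fun I => ?_)
    have hval : ∀ P, ‖(strip I).indicator ((highTritiles u L)ᶜ.indicator
        fun P => ((‖walshEmbedding f P‖ : ℝ) : ℂ)) P‖ =
        (strip I ∩ (highTritiles u L)ᶜ).indicator (fun P => ‖walshEmbedding f P‖) P := by
      intro P
      rw [indicator_indicator, norm_indicator_eq_indicator_norm]
      simp
    refine hsize _ I l hl (fun P => ?_) fun τ hτ => ?_
    · rw [hval]
      by_cases hP : P ∈ strip I ∩ (highTritiles u L)ᶜ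
      · rw [indicator_of_mem hP]
        exact norm_walshEmbedding_le f hf hs.le hl hP.2
      · rw [indicator_of_notMem hP]
        positivity
    · refine (treeSInfty.outerMeasure_mono fun P hP => ?_).trans
        (outerMeasure_level_le hs hsr hC f hf I hl hτ)
      change τ < _ at hP
      rw [hval] at hP
      by_cases hP' : P ∈ strip I ∩ (highTritiles u L)ᶜ
      · rw [indicator_of_mem hP'] at hP
        exact ⟨hP'.1, hP'.2, hP⟩
      · rw [indicator_of_notMem hP'] at hP
        exact absurd hP (not_lt.2 hτ.le)
  refine h1.trans ?_
  have hL2 : L / 2 = ENNReal.ofReal (l ^ s / 2) := by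
    rw [ENNReal.ofReal_div_of_pos two_pos, ENNReal.ofReal_ofNat]
  -- Where `‖f‖ ≤ l / 2`, `‖f‖ ^ s ≤ l ^ s / 2 ^ s ≤ L / 2`, so only the part above `l / 2` is
  -- charged; this truncation makes the integral over levels converge.
  have h2 := outerMeasure_highTritiles_mul_le (q := q) (u := u)
    (w := {x | l / 2 < ‖f x‖}.indicator u) (L := L) (by simpa [hL] using hls)
    ENNReal.ofReal_ne_top hufin (fun x => by
      by_cases hx : l / 2 < ‖f x‖
      · rw [indicator_of_mem (show x ∈ {x | l / 2 < ‖f x‖} from hx)]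
        exact le_self_add
      · rw [indicator_of_notMem (show x ∉ {x | l / 2 < ‖f x‖} from hx), zero_add, hL2]
        change ‖f x‖ₑ ^ s ≤ _
        rw [enorm_rpow_eq_ofReal _ hs0.le]
        refine ENNReal.ofReal_le_ofReal ?_
        refine (Real.rpow_le_rpow (norm_nonneg _) (not_lt.1 hx) hs0.le).trans ?_
        rw [Real.div_rpow hl.le two_pos.le]
        refine div_le_div_of_nonneg_left hls.le two_pos ?_
        exact Real.self_le_rpow_of_one_le one_le_two hs.le)
    (hum.indicator (measurableSet_lt measurable_const hnorm))
  have h3 : ENNReal.ofReal (2 * l ^ (-s)) * (L / 2) = 1 := by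
    rw [hL2, ← ENNReal.ofReal_mul (by positivity), Real.rpow_neg hl.le]
    rw [show 2 * (l ^ s)⁻¹ * (l ^ s / 2) = 1 by field_simp, ENNReal.ofReal_one]
  calc (stripLqSInfty q).outerMeasure (highTritiles u L)
      = ENNReal.ofReal (2 * l ^ (-s)) *
          ((stripLqSInfty q).outerMeasure (highTritiles u L) * (L / 2)) := by
        rw [mul_left_comm, h3, mul_one]
    _ ≤ _ := mul_le_mul_right h2 _

end Embedding

/-- An exponent slightly below `m` whose conjugate exponent still satisfies the bound. -/
theorem exists_exponent_lt {m r : ℝ} (hm : 1 < m) {q : ℝ≥0∞}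
    (hq : ENNReal.ofReal (m.conjExponent * (r - 1)) < q) :
    ∃ s, 1 < s ∧ s < m ∧ ENNReal.ofReal (s * (r - 1) / (s - 1)) < q := by
  have hcont : ContinuousAt (fun s : ℝ => ENNReal.ofReal (s * (r - 1) / (s - 1))) m := by
    refine ENNReal.continuous_ofReal.continuousAt.comp ?_
    exact ContinuousAt.div (by fun_prop) (by fun_prop) (by linarith)
  have h1 : ENNReal.ofReal (m * (r - 1) / (m - 1)) < q := by
    rwa [Real.conjExponent, div_mul_eq_mul_div] at hq
  have h2 : ∀ᶠ s in nhdsWithin m (Iio m),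
      1 < s ∧ s < m ∧ ENNReal.ofReal (s * (r - 1) / (s - 1)) < q := by
    filter_upwards [nhdsWithin_le_nhds (lt_mem_nhds hm), self_mem_nhdsWithin,
      nhdsWithin_le_nhds (hcont.eventually_lt_const h1)] with s ha hb hc
    exact ⟨ha, hb, hc⟩
  exact h2.exists

theorem theorem5 {X : Type u} [NormedAddCommGroup X] [NormedSpace ℂ X] [CompleteSpace X]
    (r : ℝ) (hr : 2 ≤ r) (hX : IsRHilbertian.{u, v} r X)
    (p : ℝ) (hp : 1 < p)
    (q : ℝ≥0∞) (hq : ENNReal.ofReal ((min p r).conjExponent * (r - 1)) < q) :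
    ∃ C : ℝ≥0, ∀ f : Walsh → X, IsWalshSchwartz f →
      (stripLqSInfty q).outerLp (ENNReal.ofReal p)
          (fun P => ((‖walshEmbedding f P‖ : ℝ) : ℂ)) ≤
        C * eLpNorm f (ENNReal.ofReal p) volume := by
  -- The bound `s < p` serves the maximal function and `s ≤ r` the truncation; closeness to `min p
  -- r` keeps the weak-type exponent below `q`.
  obtain ⟨s, hs, hsm, hsq⟩ := exists_exponent_lt (lt_min hp (by linarith)) hq
  have hsp : s < p := hsm.trans_le (min_le_left _ _)
  have hsr : s ≤ r := (hsm.trans_le (min_le_right _ _)).le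
  have hp0 : 0 < p := by linarith
  have hps : 0 < p - s := by linarith
  obtain ⟨C, hC⟩ := hX.exists_tile_bound hr
  have hq₀ : 0 < s * (r - 1) / (s - 1) :=
    div_pos (mul_pos (by linarith) (by linarith)) (by linarith)
  obtain ⟨B, hB, hsize⟩ := exists_averaged_size_bound hq₀ hsq C
  set D : ℝ := 2 * p * B ^ s * ((2 * B) ^ (p - s) / (p - s))
  have hD : 0 ≤ D := by positivity
  refine ⟨(D ^ (1 / p)).toNNReal, fun f hf => ?_⟩
  obtain ⟨g, rfl, hg⟩ := hf.exists_simpleFunc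
  have hpz : ENNReal.ofReal p ≠ 0 := by simpa using hp0
  rw [OuterData.outerLp, if_neg ENNReal.ofReal_ne_top,
    eLpNorm_eq_lintegral_rpow_enorm_toReal hpz ENNReal.ofReal_ne_top,
    ENNReal.toReal_ofReal hp0.le]
  have hmain : ∫⁻ t in Ioi (0 : ℝ), ENNReal.ofReal (p * t ^ (p - 1)) *
      (stripLqSInfty q).superlevel (fun P => ((‖walshEmbedding g P‖ : ℝ) : ℂ)) t ≤
      ENNReal.ofReal D * ∫⁻ x, ‖g x‖ₑ ^ p := by
    refine le_trans (setLIntegral_mono' measurableSet_Ioi fun t ht => mul_le_mul_right ?_ _)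
      (lintegral_maximal_le (by linarith) hsp hB g)
    have h := superlevel_walshEmbedding_le hs hsr
      (fun g hg τ hτ E n hE hEτ => treeSInfty_outerMeasure_mul_le hC g hg hτ E hE hEτ)
      hsize g hg (l := t / B) (div_pos ht hB)
    rwa [mul_div_cancel₀ _ hB.ne'] at h
  refine (ENNReal.rpow_le_rpow hmain (by positivity)).trans_eq ?_
  rw [ENNReal.mul_rpow_of_nonneg _ _ (by positivity),
    ENNReal.ofReal_rpow_of_nonneg hD (by positivity)]
  rfl
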